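/- Let $a$ be a positive integer, let $R=\mathbb Z/a\mathbb Z$, and let $\varepsilon>0$. For each natural number $n$, let $C_n$ be a deterministic alternating $n\times n$ matrix over $R$ (that is, $C_n^{\intercal}=-C_n$ and $C_n$ has zero diagonal), and let $X_n$ be a random $n\times n$ matrix over $R$ that is $C_n$-symmetric, meaning that $X_n-X_n^{\intercal}=C_n$ almost surely. Assume that for each $n$ the entries of $X_n$ on and above the diagonal are independent and $\varepsilon$-balanced, where an $R$-valued random variable $N$ is called $\varepsilon$-balanced if $\mathbb P[N\equiv r \pmod{\mathfrak p}]\le 1-\varepsilon$ for every maximal ideal $\mathfrak p$ of $R$ and every residue class $r\in R/\mathfrak p$. Write $\operatorname{coker}(X_n)=R^n/X_nR^n$, and write $\#\operatorname{Sur}(A,G)$ for the number of surjective group homomorphisms $A\to G$. Then the following are equivalent: \begin{enumerate} \item For every finite abelian group $G$ of exponent dividing $a$, \[\lim_{n\to\infty}\mathbb E[\#\operatorname{Sur}(\operatorname{coker}(X_n),G)]=|\wedge^2G|.\] \item $C_n=0$ for all sufficiently large $n$. \end{enumerate} -/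

import Mathlib

open MeasureTheory ProbabilityTheory Filter Topology

namespace CSymm

/-- A square matrix is alternating if it is skew-symmetric with zero diagonal. -/
def IsAlternating {R : Type*} [CommRing R] {n : ℕ} (C : Matrix (Fin n) (Fin n) R) : Prop :=
  C.transpose = -C ∧ ∀ i, C i i = 0

/-- `X` is `C`-symmetric if `X - Xᵀ = C`. -/
def IsCSymmetric {R : Type*} [CommRing R] {n : ℕ} (C X : Matrix (Fin n) (Fin n) R) : Prop :=
  X - X.transpose = C

/-- An `R`-valued random variable is `ε`-balanced if, modulo every maximal ideal, it hits each
residue class with probability at most `1 - ε`. -/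
def IsBalanced {R : Type*} [CommRing R] {Ω : Type*} [MeasurableSpace Ω] (ε : ℝ) (N : Ω → R)
    (P : Measure Ω) : Prop :=
  ∀ 𝔭 : Ideal R, 𝔭.IsMaximal → ∀ r : R ⧸ 𝔭,
    P.real {ω | Ideal.Quotient.mk 𝔭 (N ω) = r} ≤ 1 - ε

/-- `X` is a random `C`-symmetric matrix over `ℤ/aℤ` (a discrete measurable space) whose entries
on and above the diagonal are independent and `ε`-balanced. -/
structure IsBalancedCSymmetric {a n : ℕ} {Ω : Type*} [MeasurableSpace Ω] (ε : ℝ)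
    (C : Matrix (Fin n) (Fin n) (ZMod a)) (X : Ω → Matrix (Fin n) (Fin n) (ZMod a))
    (P : Measure Ω) : Prop where
  measurable : ∀ i j, Measurable fun ω => X ω i j
  cSymmetric : ∀ᵐ ω ∂P, IsCSymmetric C (X ω)
  indep : iIndepFun
    (fun (q : {q : Fin n × Fin n // q.1 ≤ q.2}) ω => X ω q.1.1 q.1.2) P
  balanced : ∀ i j, i ≤ j → IsBalanced ε (fun ω => X ω i j) P

/-- The cokernel `Rⁿ / M Rⁿ` of a square matrix `M`. -/
abbrev Coker {R : Type*} [CommRing R] {n : ℕ} (M : Matrix (Fin n) (Fin n) R) : Type _ :=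
  (Fin n → R) ⧸ LinearMap.range M.mulVecLin

/-- The number of surjective group homomorphisms from `A` onto `G`. -/
noncomputable def numSur (A G : Type*) [AddCommGroup A] [AddCommGroup G] : ℕ :=
  Nat.card {f : A →+ G // Function.Surjective f}

/-- The `G`-moment `𝔼[#Sur(coker X, G)]` of the cokernel of a random matrix `X`. -/
noncomputable def cokerMoment {R : Type*} [CommRing R] {n : ℕ} {Ω : Type*} [MeasurableSpace Ω]
    (X : Ω → Matrix (Fin n) (Fin n) R) (P : Measure Ω) (G : Type*) [AddCommGroup G] : ℝ :=
  ∫ ω, (numSur (Coker (X ω)) G : ℝ) ∂P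

end CSymm

/-! Surjections from the cokernel to `G` are the generating families `F` in `G^n` killed by the
columns of `X n`, so the moment is a sum over `F` of the probabilities of `Annihilates F`. Fourier
inversion on `G^n` writes such a probability as `|G|^(-n)` times a sum over families `D` of `ZMod
a`-valued characters. In the exponent the `(i, j)` entry on or above the diagonal has coefficient
`pairing D F i j`, and `C` enters only through a deterministic phase (`charMean_eq`). Independence
and balancedness bound the term of `D` by `ρ ^ weight D F`.

If all pairings vanish, then `D` is `φ ∘ F` for an alternating form `φ`, and there are `|∧²G|` such
`D` when `F` generates (`card_isSpecial`). When every proper subgroup misses a positive proportion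
of the members of `F` (`IsCode`), the other `D` contribute `o(1)`
(`exists_forall_sum_not_isSpecial_le`): either the weight exceeds a large multiple of `n`, or `D` is
one of polynomially many perturbations of some `φ ∘ F` and still has linear weight. The generating
`F` that are not codes are concentrated on a proper subgroup; counting them against a saving from
one member outside it shows that they are negligible (`exists_isCode_estimates`). If `C n = 0` the
phases are `1` and the limit is `|∧²G|`.

Conversely, only `G = (ℤ/a)²` is needed. A family is a pair of vectors `u, v`, and annihilation
forces `uᵀ C v = 0`. If `C n ≠ 0`, at most three quarters of all pairs satisfy this, while a code
still has probability at most about `|∧²G| / |G|^n`; so the moment stays a definite amount below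
`|∧²G|`. -/

namespace CSymm

section

open scoped Classical

/-! ### Duality for finite groups killed by `a`. -/

section Dual

variable {a : ℕ} [NeZero a] {G : Type*} [AddCommGroup G]

instance finite_dual [Finite G] : Finite (G →+ ZMod a) := DFunLike.finite _

noncomputable instance fintypeDual [Fintype G] : Fintype (G →+ ZMod a) := Fintype.ofFinite _

/-- Every complex character of a group killed by `a` factors through the standard character of
`ZMod a`. -/
theorem bijective_stdAddChar_comp (hG : ∀ x : G, a • x = 0) :
    Function.Bijective fun χ : G →+ ZMod a =>
      (ZMod.stdAddChar (N := a)).compAddMonoidHom χ := by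
  constructor
  · intro χ χ' h
    ext x
    exact ZMod.injective_stdAddChar (DFunLike.congr_fun h x)
  · intro ψ
    have hex : ∀ x : G, ∃ k : ZMod a, ZMod.stdAddChar k = ψ x := by
      intro x
      have h1 : ψ x ^ a = 1 := by rw [← AddChar.map_nsmul_eq_pow, hG, AddChar.map_zero_eq_one]
      obtain ⟨i, -, hi⟩ :=
        (Complex.isPrimitiveRoot_exp a (NeZero.ne a)).eq_pow_of_pow_eq_one h1
      refine ⟨((i : ℤ) : ZMod a), ?_⟩
      rw [ZMod.stdAddChar_coe, ← hi, ← Complex.exp_nat_mul]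
      congr 1
      push_cast
      ring
    choose k hk using hex
    refine ⟨⟨⟨k, ?_⟩, ?_⟩, ?_⟩
    · apply ZMod.injective_stdAddChar
      simp [hk]
    · intro x y
      apply ZMod.injective_stdAddChar
      simp [hk, AddChar.map_add_eq_mul]
    · ext x
      simpa using hk x

theorem card_dual [Fintype G] (hG : ∀ x : G, a • x = 0) :
    Fintype.card (G →+ ZMod a) = Fintype.card G := by
  rw [← AddChar.card_eq (α := G)]
  exact Fintype.card_of_bijective (bijective_stdAddChar_comp hG)

theorem sum_dual_stdAddChar [Fintype G] (hG : ∀ x : G, a • x = 0) (g : G) :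
    ∑ χ : G →+ ZMod a, ZMod.stdAddChar (χ g) = if g = 0 then (Fintype.card G : ℂ) else 0 := by
  rw [← AddChar.sum_apply_eq_ite]
  exact Fintype.sum_bijective _ (bijective_stdAddChar_comp hG) _ _ fun χ => by simp

theorem exists_dual_ne_zero [Finite G] (hG : ∀ x : G, a • x = 0) {g : G} (hg : g ≠ 0) :
    ∃ χ : G →+ ZMod a, χ g ≠ 0 := by
  obtain ⟨ψ, hψ⟩ := AddChar.exists_apply_ne_zero.2 hg
  obtain ⟨χ, rfl⟩ := (bijective_stdAddChar_comp hG).2 ψ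
  refine ⟨χ, fun h => hψ ?_⟩
  simp [h]

/-- The annihilator of `H` in the dual has as many elements as `G ⧸ H`. -/
theorem card_annihilator [Fintype G] (hG : ∀ x : G, a • x = 0) (H : AddSubgroup G) :
    Fintype.card {χ : G →+ ZMod a // χ.comp H.subtype = 0} * Fintype.card H = Fintype.card G := by
  have e : {χ : G →+ ZMod a // χ.comp H.subtype = 0} ≃ (G ⧸ H →+ ZMod a) :=
    { toFun := fun χ => QuotientAddGroup.lift H χ.1 fun x hx => AddMonoidHom.mem_ker.2 (DFunLike.congr_fun χ.2 ⟨x, hx⟩)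
      invFun := fun f => ⟨f.comp (QuotientAddGroup.mk' H), by
        ext x
        simp [(QuotientAddGroup.eq_zero_iff (x : G)).2 x.2]⟩
      left_inv := fun χ => by
        ext x
        simp
      right_inv := fun f => by
        ext x
        simp }
  have hQ : ∀ x : G ⧸ H, a • x = 0 := by
    intro x
    induction x using QuotientAddGroup.induction_on with
    | H z => rw [← QuotientAddGroup.mk_nsmul, hG, QuotientAddGroup.mk_zero]
  rw [Fintype.card_congr e, card_dual hQ, ← Nat.card_eq_fintype_card, ← Nat.card_eq_fintype_card,
    ← Nat.card_eq_fintype_card, ← AddSubgroup.card_eq_card_quotient_mul_card_addSubgroup]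

/-- Half of the extensions of a character from `H` to `G` are moved off a given value at a
point `g ∉ H`. -/
theorem sum_extensions_le [Fintype G] (hG : ∀ x : G, a • x = 0) (H : AddSubgroup G) {g : G}
    (hg : g ∉ H) (η : H →+ ZMod a) (c : ZMod a) {ρ : ℝ} (hρ0 : 0 ≤ ρ) (hρ1 : ρ ≤ 1) :
    ∑ χ : G →+ ZMod a with χ.comp H.subtype = η, (if χ g = c then 1 else ρ) ≤
      (Fintype.card G / Fintype.card H : ℝ) * ((1 + ρ) / 2) := by
  set S : Finset (G →+ ZMod a) := Finset.univ.filter fun χ => χ.comp H.subtype = η with hS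
  -- Translation by `χ₀` preserves the restriction to `H` and changes the value at `g`, so it
  -- injects the extensions with value `c` into those with another value.
  obtain ⟨χ₀, hχ₀, hχ₀g⟩ : ∃ χ₀ : G →+ ZMod a, χ₀.comp H.subtype = 0 ∧ χ₀ g ≠ 0 := by
    have hQ : ∀ x : G ⧸ H, a • x = 0 := by
      intro x
      induction x using QuotientAddGroup.induction_on with
      | H z => rw [← QuotientAddGroup.mk_nsmul, hG, QuotientAddGroup.mk_zero]
    have : (QuotientAddGroup.mk g : G ⧸ H) ≠ 0 := by
      rwa [Ne, QuotientAddGroup.eq_zero_iff]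
    obtain ⟨χ, hχ⟩ := exists_dual_ne_zero (a := a) hQ this
    refine ⟨χ.comp (QuotientAddGroup.mk' H), ?_, hχ⟩
    ext x
    simp [(QuotientAddGroup.eq_zero_iff (x : G)).2 x.2]
  have hcardS : S.card ≤ Fintype.card {χ : G →+ ZMod a // χ.comp H.subtype = 0} := by
    rcases S.eq_empty_or_nonempty with h | ⟨χ₁, h₁⟩
    · simp [h]
    · rw [Fintype.card_subtype]
      have h₁' : χ₁.comp H.subtype = η := by simpa [hS] using h₁
      refine Finset.card_le_card_of_injOn (fun χ => χ - χ₁) ?_ fun x _ y _ h => sub_left_injective h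
      intro χ hχ
      have hχ' : χ.comp H.subtype = η := by simpa [hS] using hχ
      simp only [Finset.coe_filter, Finset.mem_univ, true_and, Set.mem_ofPred_eq]
      ext x
      have e1 := DFunLike.congr_fun hχ' x
      have e2 := DFunLike.congr_fun h₁' x
      simp only [AddMonoidHom.comp_apply, AddSubgroup.subtype_apply] at e1 e2
      simp [e1, e2]
  have hgb : (S.filter fun χ => χ g = c).card ≤ (S.filter fun χ => ¬ χ g = c).card := by
    refine Finset.card_le_card_of_injOn (fun χ => χ + χ₀) ?_ fun x _ y _ h => add_left_injective _ h
    intro χ hχ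
    simp only [Finset.coe_filter, hS, Finset.mem_filter, Finset.mem_univ, true_and,
      Set.mem_ofPred_eq] at hχ ⊢
    refine ⟨?_, ?_⟩
    · rw [AddMonoidHom.add_comp, hχ.1, hχ₀, add_zero]
    · simp [hχ.2, hχ₀g]
  have hsplit := Finset.card_filter_add_card_filter_not (s := S) (fun χ => χ g = c)
  have hann := card_annihilator hG H
  have hHpos : (0 : ℝ) < Fintype.card H := by exact_mod_cast Fintype.card_pos
  rw [Finset.sum_ite, Finset.sum_const, Finset.sum_const, nsmul_eq_mul, nsmul_eq_mul]
  have hm : (Fintype.card G / Fintype.card H : ℝ) =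
      Fintype.card {χ : G →+ ZMod a // χ.comp H.subtype = 0} := by
    rw [← hann]
    push_cast
    field_simp
  rw [hm]
  have h1 : ((S.filter fun χ => χ g = c).card : ℝ) ≤ (S.filter fun χ => ¬ χ g = c).card := by
    exact_mod_cast hgb
  have h2 : ((S.filter fun χ => χ g = c).card : ℝ) + (S.filter fun χ => ¬ χ g = c).card = S.card := by
    exact_mod_cast hsplit
  have h3 : (S.card : ℝ) ≤ Fintype.card {χ : G →+ ZMod a // χ.comp H.subtype = 0} := by
    exact_mod_cast hcardS
  nlinarith [mul_nonneg (sub_nonneg.2 h3) (by linarith : 0 ≤ 1 + ρ),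
    mul_nonneg (sub_nonneg.2 h1) (sub_nonneg.2 hρ1)]

end Dual

/-! ### Pairings of families with characters, and their near-vanishing. -/

section Pairing

variable {a : ℕ} {G : Type*} [AddCommGroup G] {ι : Type*}

/-- The coefficient of the `(i, j)` entry of a symmetric matrix `S` in `∑ j, D j (∑ i, S i j • F i)`. -/
noncomputable def pairing (D : ι → G →+ ZMod a) (F : ι → G) (i j : ι) : ZMod a :=
  if i = j then D i (F i) else D i (F j) + D j (F i)

theorem pairing_comm (D : ι → G →+ ZMod a) (F : ι → G) (i j : ι) :
    pairing D F i j = pairing D F j i := by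
  unfold pairing
  by_cases h : i = j
  · subst h; rfl
  · rw [if_neg h, if_neg (Ne.symm h), add_comm]

theorem add_eq_zero_of_pairing {D : ι → G →+ ZMod a} {F : ι → G} {i j : ι}
    (h : pairing D F i j = 0) : D i (F j) + D j (F i) = 0 := by
  unfold pairing at h
  split_ifs at h with hij
  · subst hij; simp [h]
  · exact h

/-- The number of ordered pairs with nonzero pairing. -/
noncomputable def weight [Fintype ι] (D : ι → G →+ ZMod a) (F : ι → G) : ℕ :=
  (Finset.univ.filter fun q : ι × ι => pairing D F q.1 q.2 ≠ 0).card

/-- The number of nonzero pairings in a row. -/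
noncomputable def rowWeight [Fintype ι] (D : ι → G →+ ZMod a) (F : ι → G) (j : ι) : ℕ :=
  (Finset.univ.filter fun i : ι => pairing D F i j ≠ 0).card

/-- All pairings vanish. -/
def IsSpecial (D : ι → G →+ ZMod a) (F : ι → G) : Prop :=
  ∀ i j, pairing D F i j = 0

/-- The number of `i` with `F i` outside of `K`. -/
noncomputable def numOutside [Fintype ι] (F : ι → G) (K : AddSubgroup G) : ℕ :=
  (Finset.univ.filter fun i => F i ∉ K).card

theorem sum_rowWeight [Fintype ι] (D : ι → G →+ ZMod a) (F : ι → G) :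
    ∑ j, rowWeight D F j = weight D F := by
  unfold rowWeight weight
  simp only [Finset.card_filter]
  rw [Fintype.sum_prod_type_right]

theorem rowWeight_le_weight [Fintype ι] (D : ι → G →+ ZMod a) (F : ι → G) (j : ι) :
    rowWeight D F j ≤ weight D F := by
  rw [← sum_rowWeight]
  exact Finset.single_le_sum (f := rowWeight D F) (fun _ _ => Nat.zero_le _) (Finset.mem_univ j)

/-- A homomorphism which kills all but few of the `F i` is zero. -/
theorem eq_zero_of_numOutside [Fintype ι] {A : Type*} [AddCommGroup A] {F : ι → G} {d : ℕ}
    (hF : ∀ K : AddSubgroup G, K ≠ ⊤ → d ≤ numOutside F K) (f : G →+ A) {U : Finset ι}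
    (hU : U.card < d) (h : ∀ i ∉ U, f (F i) = 0) : f = 0 := by
  by_contra hf
  have h1 := hF f.ker fun h' => hf (AddMonoidHom.ker_eq_top_iff.1 h')
  have h2 : numOutside F f.ker ≤ U.card := by
    refine Finset.card_le_card fun i hi => ?_
    by_contra hiU
    simp [h i hiU] at hi
  omega

/-- A family of characters whose pairings with a robustly generating family mostly vanish is
mostly given by an antisymmetric homomorphism into the dual. -/
theorem exists_antisymm_hom [NeZero a] [Fintype G] [Fintype ι] {F : ι → G} {D : ι → G →+ ZMod a}
    {d g : ℕ} (hF : ∀ K : AddSubgroup G, K ≠ ⊤ → d ≤ numOutside F K) {B : Finset ι}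
    (hB : ∀ j ∉ B, rowWeight D F j ≤ g)
    (h1 : Fintype.card (G × (G →+ ZMod a)) * g < d) (h2 : g + B.card < d) :
    ∃ φ : G →+ G →+ ZMod a, (∀ x y, φ x y + φ y x = 0) ∧ ∀ j ∉ B, D j = φ (F j) := by
  set T : Set (G × (G →+ ZMod a)) := {q | ∃ j ∉ B, (F j, D j) = q} with hT
  set H := AddSubgroup.closure T with hH
  -- One exceptional set is chosen per value of `(F j, D j)` rather than per index `j`. There are
  -- boundedly many values, so the union of these sets stays below `d`, and off that union the
  -- relation extends additively to all of `H`.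
  have hrep : ∀ q : G × (G →+ ZMod a), ∃ U : Finset ι, U.card ≤ g ∧
      (q ∈ T → ∀ i ∉ U, q.2 (F i) + D i q.1 = 0) := by
    intro q
    by_cases hq : q ∈ T
    · obtain ⟨j, hj, rfl⟩ := hq
      refine ⟨_, hB j hj, fun _ i hi => ?_⟩
      have : pairing D F i j = 0 := by simpa using hi
      rw [add_comm]
      exact add_eq_zero_of_pairing this
    · exact ⟨∅, by simp, fun h => absurd h hq⟩
  choose U hUc hU using hrep
  set V : Finset ι := Finset.univ.biUnion U with hV
  have hVc : V.card < d := by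
    refine lt_of_le_of_lt ?_ h1
    refine Finset.card_biUnion_le.trans ?_
    refine (Finset.sum_le_card_nsmul _ _ g fun q _ => hUc q).trans ?_
    simp
  have hHV : ∀ q ∈ H, ∀ i ∉ V, q.2 (F i) + D i q.1 = 0 := by
    intro q hq i hi
    induction hq using AddSubgroup.closure_induction with
    | mem q hq =>
      refine hU q hq i fun h => hi ?_
      exact Finset.mem_biUnion.2 ⟨q, Finset.mem_univ _, h⟩
    | zero => simp
    | add p q _ _ hp hq =>
      simp only [Prod.fst_add, Prod.snd_add, AddMonoidHom.add_apply, map_add]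
      linear_combination hp + hq
    | neg p _ hp =>
      simp only [Prod.fst_neg, Prod.snd_neg, AddMonoidHom.neg_apply, map_neg]
      linear_combination -hp
  have hmem : ∀ j ∉ B, (F j, D j) ∈ H := fun j hj => AddSubgroup.subset_closure ⟨j, hj, rfl⟩
  -- `H` is the graph of the desired `φ`: an element `(0, χ)` of `H` has `χ` killing almost all `F
  -- i`, and the projection to `G` contains every `F j` with `j ∉ B`.
  have hbij : Function.Bijective (Prod.fst ∘ H.subtype) := by
    constructor
    · have : Function.Injective ((AddMonoidHom.fst G (G →+ ZMod a)).comp H.subtype) := by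
        rw [injective_iff_map_eq_zero]
        rintro ⟨⟨x, χ⟩, hq⟩ hx
        have hx' : x = 0 := hx
        subst hx'
        have : χ = 0 := eq_zero_of_numOutside hF χ hVc fun i hi => by
          simpa using hHV _ hq i hi
        subst this
        rfl
      exact this
    · have htop : H.map (AddMonoidHom.fst G (G →+ ZMod a)) = ⊤ := by
        by_contra hne
        have h3 := hF _ hne
        have h4 : numOutside F (H.map (AddMonoidHom.fst G (G →+ ZMod a))) ≤ B.card := by
          refine Finset.card_le_card fun i hi => ?_
          by_contra hiB
          refine (Finset.mem_filter.1 hi).2 ?_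
          exact ⟨_, hmem i hiB, rfl⟩
        omega
      intro x
      have hx : x ∈ H.map (AddMonoidHom.fst G (G →+ ZMod a)) := by rw [htop]; trivial
      obtain ⟨q, hq, rfl⟩ := hx
      exact ⟨⟨q, hq⟩, rfl⟩
  obtain ⟨φ, hφ⟩ := AddSubgroup.exists_eq_graph hbij
  have hDφ : ∀ j ∉ B, D j = φ (F j) := by
    intro j hj
    have := hmem j hj
    rw [hφ] at this
    exact (AddMonoidHom.mem_graph.1 this).symm
  refine ⟨φ, ?_, hDφ⟩
  -- Antisymmetry is spread from the members of the family to `G` one argument at a time.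
  have hfix : ∀ j ∉ B, ∀ x, φ (F j) x + φ x (F j) = 0 := by
    intro j hj x
    have hz : φ (F j) + φ.flip (F j) = 0 := by
      refine eq_zero_of_numOutside hF _
        (U := (Finset.univ.filter fun i : ι => pairing D F i j ≠ 0) ∪ B) ?_ fun i hi => ?_
      · refine (Finset.card_union_le _ _).trans_lt ?_
        have := hB j hj
        unfold rowWeight at this
        omega
      · rw [Finset.mem_union, not_or] at hi
        have hp : pairing D F i j = 0 := by simpa using hi.1
        have := add_eq_zero_of_pairing hp
        rw [hDφ j hj, hDφ i hi.2] at this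
        rw [AddMonoidHom.add_apply, AddMonoidHom.flip_apply, add_comm]
        exact this
    simpa using DFunLike.congr_fun hz x
  intro x y
  have hz : φ.flip x + φ x = 0 := by
    refine eq_zero_of_numOutside hF _ (U := B) (by omega) fun j hj => ?_
    simpa using hfix j hj x
  have := DFunLike.congr_fun hz y
  simp only [AddMonoidHom.add_apply, AddMonoidHom.flip_apply, AddMonoidHom.zero_apply] at this
  rw [add_comm]
  exact this

/-- A non-special family which is mostly given by an antisymmetric homomorphism has large weight. -/
theorem le_weight_of_not_isSpecial [Fintype ι] {F : ι → G} {D : ι → G →+ ZMod a}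
    {d : ℕ} (hF : ∀ K : AddSubgroup G, K ≠ ⊤ → d ≤ numOutside F K) {B : Finset ι}
    {φ : G →+ G →+ ZMod a} (hφ : ∀ x y, φ x y + φ y x = 0) (hD : ∀ j ∉ B, D j = φ (F j))
    (hns : ¬ IsSpecial D F) : d ≤ weight D F + B.card := by
  -- For alternating `φ`, some `D j` must differ from `φ (F j)`, and row `j` then has many nonzero
  -- entries. Otherwise `x ↦ φ x x`, additive by antisymmetry, is nonzero and many diagonal entries
  -- survive.
  by_cases halt : ∀ x, φ x x = 0
  · obtain ⟨j, hj⟩ : ∃ j, D j ≠ φ (F j) := by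
      by_contra! hall
      refine hns fun i j => ?_
      unfold pairing
      split_ifs with hij
      · rw [hall, halt]
      · rw [hall, hall, hφ]
    have hjB : j ∈ B := by
      by_contra h
      exact hj (hD j h)
    have hker : (D j - φ (F j)).ker ≠ ⊤ := fun h =>
      hj (sub_eq_zero.1 (AddMonoidHom.ker_eq_top_iff.1 h))
    refine (hF _ hker).trans ?_
    refine le_trans ?_ (Nat.add_le_add_right (rowWeight_le_weight D F j) _)
    unfold numOutside rowWeight
    refine le_trans (Finset.card_le_card fun i hi => ?_) (Finset.card_union_le _ B)
    rw [Finset.mem_union]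
    by_cases hiB : i ∈ B
    · exact Or.inr hiB
    · left
      have hij : i ≠ j := fun h => hiB (h ▸ hjB)
      simp only [Finset.mem_filter, Finset.mem_univ, true_and, AddMonoidHom.mem_ker,
        AddMonoidHom.sub_apply] at hi ⊢
      unfold pairing
      rw [if_neg hij, hD i hiB]
      intro h
      apply hi
      linear_combination h - hφ (F i) (F j)
  · let f : G →+ ZMod a := AddMonoidHom.mk' (fun x => φ x x) fun x y => by
      simp only [map_add, AddMonoidHom.add_apply]
      linear_combination hφ x y
    have hker : f.ker ≠ ⊤ := fun h => halt fun x =>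
      DFunLike.congr_fun (AddMonoidHom.ker_eq_top_iff.1 h) x
    refine (hF _ hker).trans ?_
    have hle : (Finset.univ.filter fun i => pairing D F i i ≠ 0).card ≤ weight D F := by
      refine Finset.card_le_card_of_injOn (fun i => (i, i)) (fun i hi => ?_) fun i _ j _ h =>
        (Prod.mk.inj h).1
      simpa using hi
    refine le_trans ?_ (Nat.add_le_add_right hle _)
    refine le_trans (Finset.card_le_card fun i hi => ?_) (Finset.card_union_le _ B)
    rw [Finset.mem_union]
    by_cases hiB : i ∈ B
    · exact Or.inr hiB
    · left
      simp only [Finset.mem_filter, Finset.mem_univ, true_and, AddMonoidHom.mem_ker] at hi ⊢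
      unfold pairing
      rw [if_pos rfl, hD i hiB]
      exact hi

/-- There are only polynomially many families which agree with a homomorphic image of `F` outside
of at most `b` places. -/
theorem card_filter_exists_hom_le [NeZero a] [Fintype G] [Fintype ι] [DecidableEq ι] [Nonempty ι]
    (F : ι → G) (b : ℕ) :
    (Finset.univ.filter fun D : ι → G →+ ZMod a => ∃ (φ : G →+ G →+ ZMod a) (B : Finset ι),
      B.card ≤ b ∧ ∀ j ∉ B, D j = φ (F j)).card ≤
    Nat.card (G →+ G →+ ZMod a) * (Fintype.card ι * Fintype.card (G →+ ZMod a)) ^ b := by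
  have : Finite (G →+ G →+ ZMod a) := DFunLike.finite _
  have : Fintype (G →+ G →+ ZMod a) := Fintype.ofFinite _
  -- A family is encoded by `φ` and a list of `b` overridden positions with their values.
  let f : (G →+ G →+ ZMod a) × (Fin b → ι × (G →+ ZMod a)) → ι → G →+ ZMod a := fun q j =>
    if h : ∃ k, (q.2 k).1 = j then (q.2 h.choose).2 else q.1 (F j)
  have hsub : (Finset.univ.filter fun D : ι → G →+ ZMod a =>
      ∃ (φ : G →+ G →+ ZMod a) (B : Finset ι), B.card ≤ b ∧ ∀ j ∉ B, D j = φ (F j)) ⊆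
      Finset.univ.image f := by
    intro D hD
    obtain ⟨φ, B, hBb, hDB⟩ := (Finset.mem_filter.1 hD).2
    refine Finset.mem_image.2 ?_
    obtain ⟨t, ht⟩ : ∃ t : Fin b → ι, ∀ j ∈ B, ∃ k, t k = j := by
      -- Padding for the list when `B` has fewer than `b` elements; it is harmless because the true
      -- value of `D` is recorded there too.
      let i₀ : ι := Classical.arbitrary ι
      refine ⟨fun k => if h : (k : ℕ) < B.card then B.equivFin.symm ⟨k, h⟩ else i₀, fun j hj => ?_⟩
      refine ⟨⟨B.equivFin ⟨j, hj⟩, (B.equivFin ⟨j, hj⟩).2.trans_le hBb⟩, ?_⟩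
      simp
    refine ⟨(φ, fun k => (t k, D (t k))), Finset.mem_univ _, ?_⟩
    funext j
    simp only [f]
    split_ifs with h
    · rw [h.choose_spec]
    · refine (hDB j fun hj => h (ht j hj)).symm
  have hcard := (Finset.card_le_card hsub).trans Finset.card_image_le
  rw [Finset.card_univ, Fintype.card_prod, Fintype.card_pi_const, Fintype.card_prod,
    ← Nat.card_eq_fintype_card (α := G →+ G →+ ZMod a)] at hcard
  refine (le_of_eq ?_).trans hcard
  congr!

end Pairing

/-! ### Non-special characters against a code. -/

section CodeEstimate

variable {a : ℕ} [NeZero a] {G : Type*} [AddCommGroup G] [Fintype G]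

/-- For a robustly generating family the non-special characters contribute a negligible amount. -/
theorem exists_forall_sum_not_isSpecial_le (hG : ∀ x : G, a • x = 0) {ρ δ τ : ℝ} (hρ0 : 0 < ρ)
    (hρ1 : ρ < 1) (hδ : 0 < δ) (hτ : 0 < τ) :
    ∃ n₀ : ℕ, ∀ (ι : Type) [Fintype ι] [DecidableEq ι], n₀ ≤ Fintype.card ι → ∀ F : ι → G,
      (∀ K : AddSubgroup G, K ≠ ⊤ → δ * Fintype.card ι ≤ numOutside F K) →
      ∑ D : ι → G →+ ZMod a with ¬ IsSpecial D F, ρ ^ weight D F ≤ τ := by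
  set m : ℕ := Fintype.card G with hm
  have hmpos : (0 : ℝ) < m := by exact_mod_cast Fintype.card_pos
  -- With `m * ρ ^ k < 1 / 2`, all `m ^ n` families of weight at least `k * n` together contribute
  -- at most `(1 / 2) ^ n`.
  obtain ⟨k, hk⟩ := exists_pow_lt_of_lt_one (show (0 : ℝ) < 1 / (2 * m) by positivity) hρ1
  set M : ℕ := Fintype.card (G × (G →+ ZMod a)) with hM
  have hMpos : (0 : ℝ) < M := by exact_mod_cast Fintype.card_pos
  have hM1 : (1 : ℝ) ≤ M := by exact_mod_cast Fintype.card_pos (α := G × (G →+ ZMod a))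
  -- A row is heavy when its weight exceeds `γ * n`. This `γ` keeps the `M` exceptional sets of
  -- `exists_antisymm_hom` within `δ * n / 4`, and weight below `k * n` leaves at most `k / γ` heavy
  -- rows.
  set γ : ℝ := δ / (4 * M) with hγ
  have hγpos : 0 < γ := by positivity
  set b : ℕ := ⌈k / γ⌉₊ with hb
  obtain ⟨L, hL⟩ := exists_nat_gt (2 / δ)
  have hLpos : 0 < L := by
    have : (0 : ℝ) < L := lt_trans (by positivity) hL
    exact_mod_cast this
  -- An `L`-th root of `ρ` turns the bound `weight ≥ δ * n / 2 ≥ n / L` into the decay `r ^ n`,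
  -- which beats the polynomial count of such families.
  obtain ⟨r, hr0, hr1, hrL⟩ : ∃ r : ℝ, 0 < r ∧ r < 1 ∧ r ^ L = ρ := by
    refine ⟨ρ ^ ((L : ℝ)⁻¹), Real.rpow_pos_of_pos hρ0 _,
      Real.rpow_lt_one hρ0.le hρ1 (by positivity), ?_⟩
    exact Real.rpow_inv_natCast_pow hρ0.le hLpos.ne'
  set c : ℝ := Nat.card (G →+ G →+ ZMod a) * (m : ℝ) ^ b with hc
  have hlim : Tendsto (fun n : ℕ => (1 / 2 : ℝ) ^ n + c * ((n : ℝ) ^ b * r ^ n)) atTop (𝓝 0) := by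
    have h1 := tendsto_pow_atTop_nhds_zero_of_lt_one (r := (1 / 2 : ℝ)) (by norm_num) (by norm_num)
    have h2 := tendsto_pow_const_mul_const_pow_of_abs_lt_one b
      (show |r| < 1 by rwa [abs_of_pos hr0])
    simpa using h1.add (h2.const_mul c)
  obtain ⟨n₁, hn₁⟩ := eventually_atTop.1 (hlim.eventually (gt_mem_nhds hτ))
  obtain ⟨n₂, hn₂⟩ := exists_nat_gt (4 * b / δ)
  refine ⟨max (max n₁ n₂) 1, fun ι _ _ hι F hF => ?_⟩
  set n : ℕ := Fintype.card ι with hn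
  have hnn₁ : n₁ ≤ n := (le_max_left _ _).trans ((le_max_left _ _).trans hι)
  have hnn₂ : n₂ ≤ n := (le_max_right _ _).trans ((le_max_left _ _).trans hι)
  have hn1 : 1 ≤ n := (le_max_right _ _).trans hι
  have hnpos : (0 : ℝ) < n := by exact_mod_cast hn1
  have : Nonempty ι := Fintype.card_pos_iff.1 hn1
  have hbn : 4 * (b : ℝ) < δ * n := by
    have h : 4 * (b : ℝ) / δ < n := hn₂.trans_le (by exact_mod_cast hnn₂)
    rw [div_lt_iff₀ hδ] at h
    linarith
  set g : ℕ := ⌊γ * n⌋₊ with hg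
  set d : ℕ := ⌈δ * n⌉₊ with hd
  have hdF : ∀ K : AddSubgroup G, K ≠ ⊤ → d ≤ numOutside F K := fun K hK =>
    Nat.ceil_le.2 (hF K hK)
  have hdn : δ * n ≤ d := Nat.le_ceil _
  have hgn : (g : ℝ) ≤ γ * n := Nat.floor_le (by positivity)
  have hMγ : M * γ = δ / 4 := by
    rw [hγ]; field_simp
  have hgM : (M : ℝ) * g ≤ δ * n / 4 := by
    calc (M : ℝ) * g ≤ M * (γ * n) := by gcongr
      _ = δ * n / 4 := by rw [← mul_assoc, hMγ]; ring
  have hδn : 0 < δ * n := by positivity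
  set Q : Finset (ι → G →+ ZMod a) := Finset.univ.filter fun D : ι → G →+ ZMod a =>
    ∃ (φ : G →+ G →+ ZMod a) (B : Finset ι), B.card ≤ b ∧ ∀ j ∉ B, D j = φ (F j) with hQ
  have key : ∀ D : ι → G →+ ZMod a, ¬ IsSpecial D F →
      ρ ^ weight D F ≤ ρ ^ (k * n) + if D ∈ Q then r ^ n else 0 := by
    intro D hD
    rcases le_or_gt (k * n) (weight D F) with hw | hw
    · refine (pow_le_pow_of_le_one hρ0.le hρ1.le hw).trans (le_add_of_nonneg_right ?_)
      split_ifs <;> positivity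
    · set B : Finset ι := Finset.univ.filter fun j => g < rowWeight D F j with hB
      have hB1 : B.card * (g + 1) ≤ weight D F := by
        rw [← sum_rowWeight]
        refine le_trans ?_ (Finset.sum_le_sum_of_subset (Finset.subset_univ B))
        refine Finset.card_nsmul_le_sum B (rowWeight D F) (g + 1) fun j hj => ?_
        rw [hB, Finset.mem_filter] at hj
        exact hj.2
      have hB2 : (B.card : ℝ) * (γ * n) ≤ k * n := by
        calc (B.card : ℝ) * (γ * n) ≤ B.card * (g + 1) := by
              gcongr
              exact (Nat.lt_floor_add_one _).le
          _ ≤ weight D F := by exact_mod_cast hB1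
          _ ≤ k * n := by exact_mod_cast hw.le
      have hBb : B.card ≤ b := by
        have h : (B.card : ℝ) ≤ k / γ := by
          rw [le_div_iff₀ hγpos]
          refine le_of_mul_le_mul_right ?_ hnpos
          linarith
        exact_mod_cast h.trans (Nat.le_ceil _)
      have hBb' : (B.card : ℝ) ≤ b := by exact_mod_cast hBb
      have hgM' : (g : ℝ) ≤ M * g := le_mul_of_one_le_left (Nat.cast_nonneg _) hM1
      obtain ⟨φ, hφ, hDφ⟩ := exists_antisymm_hom (D := D) (g := g) hdF (B := B)
        (fun j hj => by simpa [hB] using hj)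
        (by
          have : (M : ℝ) * g < d := by linarith
          exact_mod_cast this)
        (by
          have : (g : ℝ) + B.card < d := by linarith
          exact_mod_cast this)
      have hDQ : D ∈ Q := Finset.mem_filter.2 ⟨Finset.mem_univ _, φ, B, hBb, hDφ⟩
      have hwt := le_weight_of_not_isSpecial hdF hφ hDφ hD
      have hwt' : (d : ℝ) ≤ weight D F + B.card := by exact_mod_cast hwt
      have hLw : n ≤ L * weight D F := by
        have h1 : δ * n / 2 ≤ weight D F := by linarith
        have h2 : (n : ℝ) ≤ L * weight D F := by
          calc (n : ℝ) = (2 / δ) * (δ * n / 2) := by field_simp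
            _ ≤ L * weight D F := by gcongr
        exact_mod_cast h2
      rw [if_pos hDQ]
      refine le_trans ?_ (le_add_of_nonneg_left (by positivity))
      rw [← hrL, ← pow_mul]
      exact pow_le_pow_of_le_one hr0.le hr1.le hLw
  have hQc : (Q.card : ℝ) ≤ c * (n : ℝ) ^ b := by
    have h := card_filter_exists_hom_le (a := a) F b
    rw [card_dual hG] at h
    calc (Q.card : ℝ) ≤ ((Nat.card (G →+ G →+ ZMod a) * (n * m) ^ b : ℕ) : ℝ) := by
          exact_mod_cast h
      _ = c * (n : ℝ) ^ b := by
          push_cast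
          rw [hc, mul_pow]
          ring
  have hmk : (m : ℝ) ^ n * ρ ^ (k * n) ≤ (1 / 2 : ℝ) ^ n := by
    rw [pow_mul, ← mul_pow]
    refine pow_le_pow_left₀ (by positivity) ?_ n
    calc (m : ℝ) * ρ ^ k ≤ m * (1 / (2 * m)) := by gcongr
      _ = 1 / 2 := by field_simp
  calc ∑ D : ι → G →+ ZMod a with ¬ IsSpecial D F, ρ ^ weight D F
      ≤ ∑ D : ι → G →+ ZMod a with ¬ IsSpecial D F,
          (ρ ^ (k * n) + if D ∈ Q then r ^ n else 0) :=
        Finset.sum_le_sum fun D hD => key D (Finset.mem_filter.1 hD).2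
    _ ≤ ∑ D : ι → G →+ ZMod a, (ρ ^ (k * n) + if D ∈ Q then r ^ n else 0) := by
        refine Finset.sum_le_sum_of_subset_of_nonneg (Finset.subset_univ _) fun D _ _ => ?_
        split_ifs <;> positivity
    _ = (m : ℝ) ^ n * ρ ^ (k * n) + Q.card * r ^ n := by
        rw [Finset.sum_add_distrib, Finset.sum_const, Finset.card_univ, Fintype.card_fun,
          card_dual hG, Finset.sum_ite_mem, Finset.univ_inter, Finset.sum_const]
        simp [hm, hn]
    _ ≤ (1 / 2 : ℝ) ^ n + c * (n : ℝ) ^ b * r ^ n := by gcongr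
    _ ≤ τ := by
        have := hn₁ n hnn₁
        simp only [mul_assoc] at this ⊢
        exact le_of_lt this

end CodeEstimate

/-! ### Special characters and the exterior square. -/

section Special

variable {a : ℕ} {G : Type*} [AddCommGroup G]

theorem nsmul_exteriorPower_eq_zero (hG : ∀ x : G, a • x = 0) (x : ⋀[ℤ]^2 G) : a • x = 0 := by
  have h : (a • LinearMap.id : ⋀[ℤ]^2 G →ₗ[ℤ] ⋀[ℤ]^2 G) = 0 := by
    refine exteriorPower.linearMap_ext ?_
    ext v
    have h1 := (exteriorPower.ιMulti ℤ 2 (M := G)).map_update_smul v 0 (a : ℤ) (v 0)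
    rw [natCast_zsmul, hG, Function.update_eq_self, AlternatingMap.map_update_zero] at h1
    simpa using congrArg Subtype.val h1.symm
  simpa using DFunLike.congr_fun h x

theorem finite_exteriorPower [NeZero a] [Finite G] (hG : ∀ x : G, a • x = 0) : Finite (⋀[ℤ]^2 G) := by
  have : Module.Finite ℤ G := Module.Finite.of_finite
  refine Module.finite_of_fg_torsion _ ?_
  intro x
  exact ⟨⟨(a : ℤ), by simp [NeZero.ne a]⟩, by
    simpa using nsmul_exteriorPower_eq_zero hG x⟩

/-- The pairing on `G` given by a homomorphism out of the exterior square. -/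
noncomputable def pairingOfExteriorPower (ψ : ⋀[ℤ]^2 G →+ ZMod a) : G →+ G →+ ZMod a :=
  AddMonoidHom.mk' (fun x => AddMonoidHom.mk' (fun y => ψ (exteriorPower.ιMulti ℤ 2 ![x, y]))
    (fun y z => by
      have h := (exteriorPower.ιMulti ℤ 2 (M := G)).map_update_add ![x, 0] 1 y z
      have hu : ∀ w : G, Function.update ![x, 0] 1 w = ![x, w] := fun w => by
        ext i; fin_cases i <;> simp
      rw [hu, hu, hu] at h
      rw [h, map_add]))
    (fun x z => by
      ext y
      simp [AlternatingMap.map_vecCons_add])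

theorem pairingOfExteriorPower_apply (ψ : ⋀[ℤ]^2 G →+ ZMod a) (x y : G) :
    pairingOfExteriorPower ψ x y = ψ (exteriorPower.ιMulti ℤ 2 ![x, y]) := rfl

/-- Alternating pairings on `G` with values in `ZMod a` are counted by the exterior square. -/
theorem card_alternating [NeZero a] [Finite G] (hG : ∀ x : G, a • x = 0) :
    Nat.card {φ : G →+ G →+ ZMod a // ∀ x, φ x x = 0} = Nat.card (⋀[ℤ]^2 G) := by
  have := finite_exteriorPower hG
  have : Fintype (⋀[ℤ]^2 G) := Fintype.ofFinite _
  -- The exterior square is itself killed by `a`, hence equinumerous with its dual, and that dual is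
  -- the group of alternating forms.
  rw [Nat.card_eq_fintype_card (α := ⋀[ℤ]^2 G), ← card_dual (nsmul_exteriorPower_eq_zero hG),
    ← Nat.card_eq_fintype_card]
  symm
  refine Nat.card_eq_of_bijective (fun ψ => ⟨pairingOfExteriorPower ψ, fun x => ?_⟩) ⟨?_, ?_⟩
  · rw [pairingOfExteriorPower_apply, AlternatingMap.map_eq_zero_of_eq _ _ (i := 0) (j := 1)]
    · simp
    · simp
    · simp
  · intro ψ ψ' h
    have h' : ψ.toIntLinearMap = ψ'.toIntLinearMap := by
      refine exteriorPower.linearMap_ext ?_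
      ext v
      have e := DFunLike.congr_fun (DFunLike.congr_fun (congrArg Subtype.val h) (v 0)) (v 1)
      simp only [pairingOfExteriorPower_apply] at e
      have hv : ![v 0, v 1] = v := by ext i; fin_cases i <;> rfl
      rw [hv] at e
      exact e
    ext x
    exact DFunLike.congr_fun h' x
  · rintro ⟨φ, hφ⟩
    have hanti : ∀ x y, φ x y + φ y x = 0 := fun x y => by
      have := hφ (x + y)
      simp only [map_add, AddMonoidHom.add_apply] at this
      linear_combination this - hφ x - hφ y
    let A : G [⋀^Fin 2]→ₗ[ℤ] ZMod a :=
      { toFun := fun v => φ (v 0) (v 1)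
        map_update_add' := fun {_} v i x y => by
          fin_cases i <;> simp [Function.update]
        map_update_smul' := fun {_} v i c x => by
          fin_cases i <;> simp [Function.update]
        map_eq_zero_of_eq' := fun v i j h hij => by
          have h01 : v 0 = v 1 := by
            fin_cases i <;> fin_cases j <;> simp_all
          rw [h01, hφ] }
    refine ⟨(exteriorPower.alternatingMapLinearEquiv A).toAddMonoidHom, Subtype.ext ?_⟩
    ext x y
    rw [pairingOfExteriorPower_apply]
    exact exteriorPower.alternatingMapLinearEquiv_apply_ιMulti A ![x, y]

/-- Special families are exactly the `φ ∘ F` with `φ` alternating. Generation means that every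
proper subgroup misses at least one member, so `exists_antisymm_hom` applies with `d = 1` and no
exceptions; the diagonal pairings upgrade antisymmetric to alternating. -/
theorem card_isSpecial [NeZero a] [Fintype G] (hG : ∀ x : G, a • x = 0) {ι : Type*} [Fintype ι]
    [DecidableEq ι] {F : ι → G}
    (hF : AddSubgroup.closure (Set.range F) = ⊤) :
    (Finset.univ.filter fun D : ι → G →+ ZMod a => IsSpecial D F).card =
      Nat.card (⋀[ℤ]^2 G) := by
  rw [← card_alternating hG, ← Fintype.card_subtype, ← Nat.card_eq_fintype_card]
  symm
  refine Nat.card_eq_of_bijective (fun φ => ⟨fun i => φ.1 (F i), fun i j => ?_⟩) ⟨?_, ?_⟩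
  · unfold pairing
    split_ifs with hij
    · exact φ.2 _
    · have := φ.2 (F i + F j)
      simp only [map_add, AddMonoidHom.add_apply] at this
      linear_combination this - φ.2 (F i) - φ.2 (F j)
  · intro φ φ' h
    refine Subtype.ext (AddMonoidHom.eq_of_eqOn_dense hF ?_)
    rintro _ ⟨i, rfl⟩
    exact congrFun (congrArg Subtype.val h) i
  · rintro ⟨D, hD⟩
    have hout : ∀ K : AddSubgroup G, K ≠ ⊤ → 1 ≤ numOutside F K := by
      intro K hK
      rw [Nat.one_le_iff_ne_zero]
      intro h0
      refine hK (top_le_iff.1 (hF ▸ (AddSubgroup.closure_le K).2 ?_))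
      rintro _ ⟨i, rfl⟩
      by_contra hi
      rw [numOutside, Finset.card_eq_zero, Finset.filter_eq_empty_iff] at h0
      exact h0 (Finset.mem_univ i) hi
    obtain ⟨φ, hφ, hDφ⟩ := exists_antisymm_hom (D := D) (g := 0) hout (B := ∅)
      (fun j _ => by simp [rowWeight, hD _ j]) (by simp) (by simp)
    let f : G →+ ZMod a := AddMonoidHom.mk' (fun x => φ x x) fun x y => by
      simp only [map_add, AddMonoidHom.add_apply]
      linear_combination hφ x y
    have hf : f = 0 := by
      refine AddMonoidHom.eq_of_eqOn_dense hF ?_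
      rintro _ ⟨i, rfl⟩
      have := hD i i
      rw [pairing, if_pos rfl, hDφ i (by simp)] at this
      exact this
    exact ⟨⟨φ, fun x => DFunLike.congr_fun hf x⟩,
      Subtype.ext (funext fun i => (hDφ i (by simp)).symm)⟩

end Special

/-! ### Families concentrated on a subgroup. -/

section Degenerate

variable {a : ℕ} {G : Type*} [AddCommGroup G] {ι : Type*}

/-- The part of a family which lies in a subgroup. -/
def restrictTo (F : ι → G) (H : AddSubgroup G) : {i // F i ∈ H} → H := fun i => ⟨F i, i.2⟩

theorem pairing_restrictTo (D : ι → G →+ ZMod a) (F : ι → G) (H : AddSubgroup G)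
    (i j : {i // F i ∈ H}) :
    pairing (fun i : {i // F i ∈ H} => (D i).comp H.subtype) (restrictTo F H) i j =
      pairing D F i j := by
  simp [pairing, restrictTo, Subtype.ext_iff]

theorem card_add_numOutside [Fintype ι] (F : ι → G) (H : AddSubgroup G) :
    Fintype.card {i // F i ∈ H} + numOutside F H = Fintype.card ι := by
  rw [Fintype.card_subtype, numOutside, Finset.card_filter_add_card_filter_not, Finset.card_univ]

/-- The row of `i₀` is disjoint from the block of indices inside `H`, so its nonzero entries come on
top of those of the block. -/
theorem weight_restrictTo_add_le [Fintype ι] (D : ι → G →+ ZMod a) (F : ι → G)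
    (H : AddSubgroup G) {i₀ : ι} (hi₀ : F i₀ ∉ H) :
    weight (fun i : {i // F i ∈ H} => (D i).comp H.subtype) (restrictTo F H) +
      (Finset.univ.filter fun j : {i // F i ∈ H} => ¬ D j (F i₀) = -D i₀ (F j)).card ≤
      weight D F := by
  unfold weight
  rw [← Finset.card_map ((Function.Embedding.subtype fun i => F i ∈ H).prodMap
      (Function.Embedding.subtype fun i => F i ∈ H)),
    ← Finset.card_image_of_injective (f := fun j : {i // F i ∈ H} => (i₀, (j : ι)))
      (Finset.univ.filter fun j : {i // F i ∈ H} => ¬ D j (F i₀) = -D i₀ (F j))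
      (fun x y h => Subtype.ext (Prod.mk.inj h).2),
    ← Finset.card_union_of_disjoint]
  · refine Finset.card_le_card fun q hq => ?_
    rcases Finset.mem_union.1 hq with hq | hq
    · obtain ⟨⟨i, j⟩, hp, rfl⟩ := Finset.mem_map.1 hq
      simp only [Finset.mem_filter, Finset.mem_univ, true_and, pairing_restrictTo] at hp
      simpa using hp
    · obtain ⟨j, hp, rfl⟩ := Finset.mem_image.1 hq
      have hne : i₀ ≠ j := fun h => hi₀ (h ▸ j.2)
      simp only [Finset.mem_filter, Finset.mem_univ, true_and] at hp ⊢
      rw [pairing, if_neg hne]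
      intro h
      exact hp (by linear_combination h)
  · rw [Finset.disjoint_left]
    intro q hq hq'
    obtain ⟨⟨i, j⟩, -, rfl⟩ := Finset.mem_map.1 hq
    obtain ⟨k, -, hk⟩ := Finset.mem_image.1 hq'
    have : i₀ = i := (Prod.mk.inj hk).1
    exact hi₀ (this ▸ i.2)

/-- If `F` is not contained in `H`, the sum over all characters is controlled by the corresponding
sum for the part of `F` inside `H`. -/
theorem sum_weight_le [NeZero a] [Fintype G] [Fintype ι] [DecidableEq ι]
    (hG : ∀ x : G, a • x = 0) (F : ι → G)
    (H : AddSubgroup G) {i₀ : ι} (hi₀ : F i₀ ∉ H) {ρ : ℝ} (hρ0 : 0 ≤ ρ) (hρ1 : ρ ≤ 1) :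
    ∑ D : ι → G →+ ZMod a, ρ ^ weight D F ≤
      (Fintype.card G : ℝ) ^ numOutside F H *
      (((Fintype.card G / Fintype.card H : ℝ) * ((1 + ρ) / 2)) ^ Fintype.card {i // F i ∈ H} *
      ∑ D' : {i // F i ∈ H} → H →+ ZMod a, ρ ^ weight D' (restrictTo F H)) := by
  let res : ({i // F i ∈ H} → G →+ ZMod a) → ({i // F i ∈ H} → H →+ ZMod a) :=
    fun D j => (D j).comp H.subtype
  let w : ({i // ¬ F i ∈ H} → G →+ ZMod a) → ({i // F i ∈ H} → G →+ ZMod a) → ℝ := fun E D =>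
    ρ ^ weight (res D) (restrictTo F H) *
      ∏ j : {i // F i ∈ H}, if D j (F i₀) = -E ⟨i₀, hi₀⟩ (F j) then (1 : ℝ) else ρ
  have hpt : ∀ D : ι → G →+ ZMod a, ρ ^ weight D F ≤ w (fun i => D i) (fun i => D i) := by
    intro D
    refine (pow_le_pow_of_le_one hρ0 hρ1 (weight_restrictTo_add_le D F H hi₀)).trans ?_
    simp only [w, res]
    rw [pow_add, Finset.prod_ite, Finset.prod_const_one, one_mul, Finset.prod_const]
  -- With the outside characters `E` frozen, the fibre over given restrictions to `H` is a product
  -- over `j`, and each factor gains `(1 + ρ) / 2` by `sum_extensions_le`.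
  have hE : ∀ E : {i // ¬ F i ∈ H} → G →+ ZMod a, ∑ D, w E D ≤
      ((Fintype.card G / Fintype.card H : ℝ) * ((1 + ρ) / 2)) ^ Fintype.card {i // F i ∈ H} *
      ∑ D' : {i // F i ∈ H} → H →+ ZMod a, ρ ^ weight D' (restrictTo F H) := by
    intro E
    rw [← Finset.sum_fiberwise Finset.univ res, Finset.mul_sum]
    refine Finset.sum_le_sum fun D' _ => ?_
    have hfib : (Finset.univ.filter fun D => res D = D') =
        Fintype.piFinset fun j => Finset.univ.filter fun χ : G →+ ZMod a =>
          χ.comp H.subtype = D' j := by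
      ext D
      simp [res, funext_iff]
    have hw : ∀ D ∈ Finset.univ.filter (fun D => res D = D'), w E D =
        ρ ^ weight D' (restrictTo F H) *
        ∏ j : {i // F i ∈ H}, if D j (F i₀) = -E ⟨i₀, hi₀⟩ (F j) then (1 : ℝ) else ρ := by
      intro D hD
      simp only [w]
      rw [(Finset.mem_filter.1 hD).2]
    rw [Finset.sum_congr rfl hw, ← Finset.mul_sum, hfib,
      ← Finset.prod_univ_sum (fun j => Finset.univ.filter fun χ : G →+ ZMod a =>
          χ.comp H.subtype = D' j)
        (fun j χ => if χ (F i₀) = -E ⟨i₀, hi₀⟩ (F j) then (1 : ℝ) else ρ), mul_comm]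
    refine mul_le_mul_of_nonneg_right ?_ (by positivity)
    rw [← Finset.card_univ (α := {i // F i ∈ H}), ← Finset.prod_const]
    refine Finset.prod_le_prod (fun j _ => ?_) fun j _ => ?_
    · exact Finset.sum_nonneg fun χ _ => by split_ifs <;> positivity
    · exact sum_extensions_le hG H hi₀ (D' j) _ hρ0 hρ1
  calc ∑ D : ι → G →+ ZMod a, ρ ^ weight D F
      ≤ ∑ D : ι → G →+ ZMod a, w (fun i => D i) (fun i => D i) :=
        Finset.sum_le_sum fun D _ => hpt D
    _ = ∑ p : ({i // F i ∈ H} → G →+ ZMod a) × ({i // ¬ F i ∈ H} → G →+ ZMod a), w p.2 p.1 :=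
        Fintype.sum_equiv (Equiv.piEquivPiSubtypeProd (fun i => F i ∈ H) fun _ => G →+ ZMod a)
          _ _ fun D => rfl
    _ = ∑ E, ∑ D, w E D := by rw [Fintype.sum_prod_type_right]
    _ ≤ _ := by
        refine (Finset.sum_le_card_nsmul _ _ _ fun E _ => hE E).trans (le_of_eq ?_)
        rw [nsmul_eq_mul, Finset.card_univ, Fintype.card_fun, card_dual hG,
          Fintype.card_subtype, numOutside]
        push_cast
        rfl

end Degenerate

/-! ### Sums over small exceptional sets. -/

section Counting

variable {G : Type*} [AddCommGroup G] [Fintype G]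

/-- The generating sum over small subsets of `Fin n`. -/
noncomputable def smallSum (L : ℕ) (m q : ℝ) (n : ℕ) : ℝ :=
  ∑ σ : Finset (Fin n) with L * σ.card ≤ n, m ^ σ.card * q ^ (n - σ.card)

/-- Exponential tilting: for `z > 1` the factor `z ^ (n - L * |σ|)` is at least `1` on the range of
summation, and the binomial theorem gives `(z * (m / z ^ L + q)) ^ n`. Taking `z` close to `1` and
then `L` large makes the base less than `1`. -/
theorem exists_tendsto_smallSum (m : ℝ) (hm : 0 ≤ m) {q : ℝ} (hq0 : 0 < q) (hq1 : q < 1) :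
    ∃ L : ℕ, 0 < L ∧ Tendsto (smallSum L m q) atTop (𝓝 0) := by
  set q₁ := (1 + q) / 2 with hq₁
  have hq₁0 : 0 < q₁ := by positivity
  have hq₁1 : q₁ < 1 := by rw [hq₁]; linarith
  set z := 2 / (1 + q₁) with hz
  have hz1 : 1 < z := by rw [hz, lt_div_iff₀ (by positivity)]; linarith
  have hz0 : 0 < z := by positivity
  have hzq : z * q₁ < 1 := by
    rw [hz, div_mul_eq_mul_div, div_lt_one (by positivity)]; linarith
  obtain ⟨L, hL⟩ := pow_unbounded_of_one_lt (m / ((1 - q) / 2)) hz1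
  have hL' : m / z ^ (L + 1) + q ≤ q₁ := by
    have h1 : m / ((1 - q) / 2) ≤ z ^ (L + 1) :=
      hL.le.trans (pow_le_pow_right₀ hz1.le (Nat.le_succ L))
    have h2 : m / z ^ (L + 1) ≤ (1 - q) / 2 := by
      rw [div_le_iff₀ (by linarith)] at h1
      rw [div_le_iff₀ (by positivity)]
      linarith
    rw [hq₁]; linarith
  refine ⟨L + 1, Nat.succ_pos L, ?_⟩
  refine squeeze_zero (fun n => Finset.sum_nonneg fun σ _ => by positivity) (fun n => ?_)
    (tendsto_pow_atTop_nhds_zero_of_lt_one (by positivity) hzq)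
  calc smallSum (L + 1) m q n
      ≤ ∑ σ : Finset (Fin n) with (L + 1) * σ.card ≤ n,
          z ^ n * ((m / z ^ (L + 1)) ^ σ.card * q ^ (n - σ.card)) := by
        refine Finset.sum_le_sum fun σ hσ => ?_
        rw [← mul_assoc]
        refine mul_le_mul_of_nonneg_right ?_ (by positivity)
        rw [div_pow m, ← pow_mul, mul_div_assoc', le_div_iff₀ (by positivity), mul_comm]
        refine mul_le_mul_of_nonneg_right ?_ (by positivity)
        exact pow_le_pow_right₀ hz1.le (Finset.mem_filter.1 hσ).2
    _ ≤ ∑ σ : Finset (Fin n), z ^ n * ((m / z ^ (L + 1)) ^ σ.card * q ^ (n - σ.card)) :=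
        Finset.sum_le_sum_of_subset_of_nonneg (Finset.subset_univ _) fun _ _ _ => by positivity
    _ = z ^ n * (m / z ^ (L + 1) + q) ^ n := by
        rw [← Finset.mul_sum, ← Fin.sum_pow_mul_eq_add_pow]
    _ ≤ z ^ n * q₁ ^ n := by gcongr
    _ = (z * q₁) ^ n := (mul_pow _ _ _).symm

/-- Counting families by the places where they leave a subgroup. -/
theorem sum_numOutside_le (H : AddSubgroup G) (L n : ℕ) (h : ℕ → ℝ) (hh : ∀ s, 0 ≤ h s) :
    ∑ F : Fin n → G with L * numOutside F H ≤ n, h (numOutside F H) ≤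
      ∑ σ : Finset (Fin n) with L * σ.card ≤ n,
        (Fintype.card G : ℝ) ^ σ.card * (Fintype.card H : ℝ) ^ (n - σ.card) * h σ.card := by
  let out : (Fin n → G) → Finset (Fin n) := fun F => Finset.univ.filter fun i => F i ∉ H
  rw [← Finset.sum_fiberwise_of_maps_to (s := Finset.univ.filter fun F : Fin n → G =>
    L * numOutside F H ≤ n) (t := Finset.univ.filter fun σ : Finset (Fin n) => L * σ.card ≤ n)
    (g := out) (fun F hF => Finset.mem_filter.2 ⟨Finset.mem_univ _, (Finset.mem_filter.1 hF).2⟩)]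
  refine Finset.sum_le_sum fun σ _ => ?_
  rw [Finset.sum_congr rfl (g := fun _ => h σ.card) (fun F hF => by
    rw [← (Finset.mem_filter.1 hF).2]; rfl), Finset.sum_const, nsmul_eq_mul]
  refine mul_le_mul_of_nonneg_right ?_ (hh _)
  have hsub : (Finset.univ.filter fun F : Fin n → G => L * numOutside F H ≤ n).filter
      (fun F => out F = σ) ⊆ Fintype.piFinset fun i => if i ∈ σ then Finset.univ else
        Finset.univ.filter fun x => x ∈ H := by
    intro F hF
    rw [Fintype.mem_piFinset]
    intro i
    split_ifs with hi
    · exact Finset.mem_univ _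
    · rw [← (Finset.mem_filter.1 hF).2] at hi
      simpa [out] using hi
  have hcard := Finset.card_le_card hsub
  rw [Fintype.card_piFinset] at hcard
  have hprod : ∏ i : Fin n, (if i ∈ σ then (Finset.univ : Finset G) else
      Finset.univ.filter fun x => x ∈ H).card =
      Fintype.card G ^ σ.card * Fintype.card H ^ (n - σ.card) := by
    have : ∀ i : Fin n, (if i ∈ σ then (Finset.univ : Finset G) else
      Finset.univ.filter fun x => x ∈ H).card = if i ∈ σ then Fintype.card G else
        Fintype.card H := by
      intro i
      split_ifs
      · rfl
      · rw [Fintype.card_subtype]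
    simp_rw [this]
    rw [Finset.prod_ite, Finset.prod_const, Finset.prod_const, Finset.filter_mem_eq_inter,
      Finset.univ_inter, Finset.filter_not, Finset.filter_mem_eq_inter, Finset.univ_inter,
      ← Finset.compl_eq_univ_sdiff, Finset.card_compl, Fintype.card_fin]
  rw [hprod] at hcard
  exact_mod_cast hcard

end Counting

/-! ### Codes, robust subgroups, and negligibility of the remaining families. -/

section Core

variable {a : ℕ} {G : Type*} [AddCommGroup G]

/-- Every proper subgroup misses at least the proportion `δ` of the members of the family. -/
def IsCode {ι : Type*} [Fintype ι] (δ : ℝ) (F : ι → G) : Prop :=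
  ∀ K : AddSubgroup G, K ≠ ⊤ → δ * Fintype.card ι ≤ numOutside F K

theorem IsCode.closure_eq_top {ι : Type*} [Fintype ι] [Nonempty ι] {δ : ℝ} (hδ : 0 < δ) {F : ι → G}
    (hF : IsCode δ F) : AddSubgroup.closure (Set.range F) = ⊤ := by
  by_contra h
  have h1 := hF _ h
  have h2 : numOutside F (AddSubgroup.closure (Set.range F)) = 0 := by
    rw [numOutside, Finset.card_eq_zero, Finset.filter_eq_empty_iff]
    intro i _ hi
    exact hi (AddSubgroup.subset_closure ⟨i, rfl⟩)
  have h3 : (0 : ℝ) < Fintype.card ι := by exact_mod_cast Fintype.card_pos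
  rw [h2] at h1
  have := mul_pos hδ h3
  simp only [Nat.cast_zero] at h1
  linarith

theorem numOutside_map_le {ι : Type*} [Fintype ι] (F : ι → G) (H : AddSubgroup G)
    (K : AddSubgroup H) :
    numOutside F (K.map H.subtype) ≤ numOutside (restrictTo F H) K + numOutside F H := by
  unfold numOutside
  rw [← Finset.card_map (Function.Embedding.subtype fun i => F i ∈ H)]
  refine (Finset.card_le_card fun i hi => ?_).trans (Finset.card_union_le _ _)
  rw [Finset.mem_union]
  by_cases hiH : F i ∈ H
  · left
    refine Finset.mem_map.2 ⟨⟨i, hiH⟩, ?_, rfl⟩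
    simp only [Finset.mem_filter, Finset.mem_univ, true_and] at hi ⊢
    exact fun h => hi ⟨_, h, rfl⟩
  · right
    simpa using hiH

variable [Fintype G]

/-- The threshold used to select the subgroup robustly generated by a family. -/
noncomputable def threshold (L : ℕ) (H : AddSubgroup G) : ℝ :=
  1 / (L * 2 ^ Fintype.card H)

theorem threshold_pos {L : ℕ} (hL : 0 < L) (H : AddSubgroup G) : 0 < threshold L H := by
  unfold threshold
  have : (0 : ℝ) < L := by exact_mod_cast hL
  positivity

/-- The halving leaves room for the members outside `H` in `isCode_of_robust`; it is the reason for
the exponent `|H|` in `threshold`. -/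
theorem two_mul_threshold_le {L : ℕ} (hL : 0 < L) {K H : AddSubgroup G} (h : K < H) :
    2 * threshold L H ≤ threshold L K := by
  unfold threshold
  have hL' : (0 : ℝ) < L := by exact_mod_cast hL
  have hc : Fintype.card K < Fintype.card H := by
    refine Set.card_lt_card (s := (K : Set G)) (t := (H : Set G)) ?_
    exact h
  rw [mul_one_div, div_le_div_iff₀ (by positivity) (by positivity)]
  have : (2 : ℝ) ^ (Fintype.card K + 1) ≤ 2 ^ Fintype.card H :=
    pow_le_pow_right₀ (by norm_num) hc
  rw [pow_succ] at this
  nlinarith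

theorem two_mul_mul_le_of_lt_threshold {L : ℕ} (hL : 0 < L) (H : AddSubgroup G) {s n : ℕ}
    (h : (s : ℝ) < threshold L H * n) : 2 * (L * s) ≤ n := by
  unfold threshold at h
  have hL' : (0 : ℝ) < L := by exact_mod_cast hL
  have h2 : (2 : ℝ) ≤ 2 ^ Fintype.card H :=
    le_self_pow₀ (by norm_num) Fintype.card_pos.ne'
  rw [one_div, inv_mul_eq_div, lt_div_iff₀ (by positivity)] at h
  have h3 : (2 : ℝ) * (L * s) ≤ n := by
    have : (L : ℝ) * s * 2 ≤ L * s * 2 ^ Fintype.card H := by gcongr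
    linarith
  exact_mod_cast h3

/-- The subgroup robustly generated by a family. -/
theorem exists_robust_subgroup {L : ℕ} (hL : 0 < L) {ι : Type*} [Fintype ι] [Nonempty ι]
    (F : ι → G) : ∃ H : AddSubgroup G, numOutside F H < threshold L H * Fintype.card ι ∧
      ∀ K < H, threshold L K * Fintype.card ι ≤ numOutside F K := by
  -- The whole group qualifies, as it misses nothing; a minimal qualifying subgroup is the one
  -- wanted.
  have hne : {H : AddSubgroup G | numOutside F H < threshold L H * Fintype.card ι}.Nonempty := by
    refine ⟨⊤, ?_⟩
    have h : numOutside F (⊤ : AddSubgroup G) = 0 := by simp [numOutside]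
    have h3 : (0 : ℝ) < Fintype.card ι := by exact_mod_cast Fintype.card_pos
    simpa [h] using mul_pos (threshold_pos hL (⊤ : AddSubgroup G)) h3
  obtain ⟨H, hH⟩ := (Set.toFinite _).exists_minimal hne
  refine ⟨H, hH.1, fun K hK => ?_⟩
  by_contra! h
  exact (hH.not_lt h) hK

/-- A proper `K < H` misses at least `2 * threshold L H * n` members, with `n` the size of the
family. Fewer than `threshold L H * n` of them lie outside `H`, so enough remain inside. -/
theorem isCode_of_robust {L : ℕ} (hL : 0 < L) {ι : Type*} [Fintype ι]
    {F : ι → G} {H : AddSubgroup G} (h1 : numOutside F H < threshold L H * Fintype.card ι)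
    (h2 : ∀ K < H, threshold L K * Fintype.card ι ≤ numOutside F K) :
    IsCode (threshold L H) (restrictTo F H) := by
  intro K hK
  have hlt : K.map H.subtype < H := by
    refine lt_of_le_of_ne (AddSubgroup.map_subtype_le K) fun h => hK ?_
    rw [eq_top_iff]
    intro x _
    have hx : (x : G) ∈ K.map H.subtype := h.symm.le x.2
    obtain ⟨y, hy, hyx⟩ := hx
    rwa [← Subtype.ext hyx]
  have h3 := h2 _ hlt
  have h4 : (numOutside F (K.map H.subtype) : ℝ) ≤
      numOutside (restrictTo F H) K + numOutside F H := by exact_mod_cast numOutside_map_le F H K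
  have h5 : 2 * threshold L H * Fintype.card ι ≤
      threshold L (K.map H.subtype) * Fintype.card ι := by
    gcongr
    exact two_mul_threshold_le hL hlt
  have h6 : (Fintype.card {i // F i ∈ H} : ℝ) ≤ Fintype.card ι := by
    exact_mod_cast Fintype.card_subtype_le _
  have h7 := mul_le_mul_of_nonneg_left h6 (threshold_pos hL H).le
  linarith

/-- A union bound over the proper subgroups, each of which has density at most `1 / 2 ≤ q` in `G`.
-/
theorem card_not_isCode_div_le {L : ℕ} (hL : 0 < L) {q : ℝ} (hq : 1 / 2 ≤ q) (n : ℕ) :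
    ((Finset.univ.filter fun F : Fin n → G =>
        ¬ IsCode (threshold L (⊤ : AddSubgroup G)) F).card : ℝ) / (Fintype.card G : ℝ) ^ n ≤
      Fintype.card (AddSubgroup G) * smallSum L (Fintype.card G) q n := by
  have hm1 : (1 : ℝ) ≤ Fintype.card G := by exact_mod_cast Fintype.card_pos (α := G)
  have hm0 : (0 : ℝ) < Fintype.card G := by linarith
  have hsub : (Finset.univ.filter fun F : Fin n → G =>
      ¬ IsCode (threshold L (⊤ : AddSubgroup G)) F) ⊆
      (Finset.univ.filter fun K : AddSubgroup G => K ≠ ⊤).biUnion fun K =>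
        Finset.univ.filter fun F : Fin n → G => L * numOutside F K ≤ n := by
    intro F hF
    have hF' := (Finset.mem_filter.1 hF).2
    unfold IsCode at hF'
    push Not at hF'
    obtain ⟨K, hK, hlt⟩ := hF'
    refine Finset.mem_biUnion.2 ⟨K, by simpa using hK, ?_⟩
    rw [Fintype.card_fin] at hlt
    have := two_mul_mul_le_of_lt_threshold hL _ hlt
    simp only [Finset.mem_filter, Finset.mem_univ, true_and]
    omega
  have hK : ∀ K : AddSubgroup G, K ≠ ⊤ →
      ((Finset.univ.filter fun F : Fin n → G => L * numOutside F K ≤ n).card : ℝ) /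
        (Fintype.card G : ℝ) ^ n ≤ smallSum L (Fintype.card G) q n := by
    intro K hK
    have h := sum_numOutside_le K L n (fun _ => 1 / (Fintype.card G : ℝ) ^ n)
      fun _ => by positivity
    rw [Finset.sum_const, nsmul_eq_mul, mul_one_div] at h
    refine h.trans (Finset.sum_le_sum fun σ _ => ?_)
    have hσ : σ.card ≤ n := by simpa using Finset.card_le_univ σ
    have hKm : (Fintype.card K : ℝ) / Fintype.card G ≤ q := by
      have hdvd : 2 * Fintype.card K ≤ Fintype.card G := by
        have h1 := K.index_mul_card
        have h2 : K.index ≠ 1 := fun h => hK (AddSubgroup.index_eq_one.1 h)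
        have h3 : K.index ≠ 0 := AddSubgroup.index_ne_zero_of_finite
        rw [Nat.card_eq_fintype_card, Nat.card_eq_fintype_card] at h1
        rw [← h1]
        exact Nat.mul_le_mul_right _ (by omega)
      have hdvd' : 2 * (Fintype.card K : ℝ) ≤ Fintype.card G := by exact_mod_cast hdvd
      rw [div_le_iff₀ hm0]
      nlinarith
    have hq0 : 0 < q := by linarith
    calc (Fintype.card G : ℝ) ^ σ.card * (Fintype.card K : ℝ) ^ (n - σ.card) *
          (1 / (Fintype.card G : ℝ) ^ n)
        = ((Fintype.card K : ℝ) / Fintype.card G) ^ (n - σ.card) := by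
          rw [div_pow, mul_one_div, div_eq_div_iff (by positivity) (by positivity),
            mul_right_comm, ← pow_add, Nat.add_sub_cancel' hσ, mul_comm]
      _ ≤ q ^ (n - σ.card) := by gcongr
      _ ≤ (Fintype.card G : ℝ) ^ σ.card * q ^ (n - σ.card) :=
          le_mul_of_one_le_left (by positivity) (one_le_pow₀ hm1)
  have hcard : ((Finset.univ.filter fun F : Fin n → G =>
      ¬ IsCode (threshold L (⊤ : AddSubgroup G)) F).card : ℝ) ≤
      ∑ K : AddSubgroup G with K ≠ ⊤,
        ((Finset.univ.filter fun F : Fin n → G => L * numOutside F K ≤ n).card : ℝ) := by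
    exact_mod_cast (Finset.card_le_card hsub).trans Finset.card_biUnion_le
  have hS0 : 0 ≤ smallSum L (Fintype.card G) q n := Finset.sum_nonneg fun σ _ => by positivity
  refine (div_le_div_of_nonneg_right hcard (by positivity)).trans ?_
  rw [Finset.sum_div, ← nsmul_eq_mul]
  refine (Finset.sum_le_card_nsmul _ _ _ fun K hK' => hK K (Finset.mem_filter.1 hK').2).trans ?_
  exact nsmul_le_nsmul_left hS0 (Finset.card_le_univ _)

/-- A generating family which is not robustly generating has small weight sum. -/
theorem exists_sum_weight_le_of_not_isCode [NeZero a] (hG : ∀ x : G, a • x = 0) {ρ : ℝ}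
    (hρ0 : 0 < ρ) (hρ1 : ρ < 1) {L : ℕ} (hL : 0 < L) :
    ∃ (c : AddSubgroup G → ℝ) (n₁ : ℕ), (∀ H, 0 ≤ c H) ∧ ∀ n, n₁ ≤ n → ∀ F : Fin n → G,
      AddSubgroup.closure (Set.range F) = ⊤ → ¬ IsCode (threshold L (⊤ : AddSubgroup G)) F →
      ∃ H : AddSubgroup G, L * numOutside F H ≤ n ∧
        ∑ D : Fin n → G →+ ZMod a, ρ ^ weight D F ≤
          (Fintype.card G : ℝ) ^ numOutside F H *
            (((Fintype.card G / Fintype.card H : ℝ) * ((1 + ρ) / 2)) ^ (n - numOutside F H) *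
              c H) := by
  have hGH : ∀ (H : AddSubgroup G) (x : H), a • x = 0 := fun H x => Subtype.ext (hG x)
  have hcode : ∀ H : AddSubgroup G, ∃ n₀ : ℕ, ∀ (ι : Type) [Fintype ι] [DecidableEq ι],
      n₀ ≤ Fintype.card ι → ∀ F : ι → H, IsCode (threshold L H) F →
      ∑ D : ι → H →+ ZMod a with ¬ IsSpecial D F, ρ ^ weight D F ≤ 1 := fun H =>
    exists_forall_sum_not_isSpecial_le (hGH H) hρ0 hρ1 (threshold_pos hL H) one_pos
  choose n₀ hn₀ using hcode
  -- Inside `H` the special characters number `|∧²H|` and the others contribute at most `1`. At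
  -- least half of the members lie in `H`, so `n ≥ 2 * ∑ n₀` makes that part long enough for every
  -- `H`.
  refine ⟨fun H => Nat.card (⋀[ℤ]^2 H) + 1, 2 * (∑ H, n₀ H) + 1, fun H => by positivity, ?_⟩
  intro n hn F hFgen hFcode
  have : Nonempty (Fin n) := ⟨⟨0, by omega⟩⟩
  obtain ⟨H, hH1, hH2⟩ := exists_robust_subgroup hL F
  have hHtop : H ≠ ⊤ := by
    rintro rfl
    refine hFcode fun K hK => le_trans ?_ (hH2 K hK.lt_top)
    have h1 := two_mul_threshold_le hL (lt_top_iff_ne_top.2 hK)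
    have h2 := threshold_pos hL (⊤ : AddSubgroup G)
    gcongr
    linarith
  obtain ⟨i₀, hi₀⟩ : ∃ i₀, F i₀ ∉ H := by
    by_contra! hall
    refine hHtop (top_le_iff.1 (hFgen ▸ (AddSubgroup.closure_le H).2 ?_))
    rintro _ ⟨i, rfl⟩
    exact hall i
  have hHcode := isCode_of_robust hL hH1 hH2
  rw [Fintype.card_fin] at hH1
  have hLs := two_mul_mul_le_of_lt_threshold hL _ hH1
  have hcs := card_add_numOutside F H
  rw [Fintype.card_fin] at hcs
  have hsle : numOutside F H ≤ L * numOutside F H := Nat.le_mul_of_pos_left _ hL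
  have hn₀le : n₀ H ≤ ∑ H, n₀ H :=
    Finset.single_le_sum (f := n₀) (fun _ _ => Nat.zero_le _) (Finset.mem_univ H)
  have : Nonempty {i // F i ∈ H} := Fintype.card_pos_iff.1 (by omega)
  refine ⟨H, by omega, (sum_weight_le hG F H hi₀ hρ0.le hρ1.le).trans ?_⟩
  rw [show n - numOutside F H = Fintype.card {i // F i ∈ H} by omega]
  refine mul_le_mul_of_nonneg_left (mul_le_mul_of_nonneg_left ?_ (by positivity)) (by positivity)
  rw [← Finset.sum_filter_add_sum_filter_not Finset.univ
    fun D' : {i // F i ∈ H} → H →+ ZMod a => IsSpecial D' (restrictTo F H)]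
  refine add_le_add ?_ (hn₀ H _ (by omega) _ hHcode)
  rw [← card_isSpecial (hGH H) (hHcode.closure_eq_top (threshold_pos hL H)),
    Finset.card_eq_sum_ones]
  push_cast
  exact Finset.sum_le_sum fun D _ => pow_le_one₀ hρ0.le hρ1.le

/-- The `|H| ^ (n - s)` choices inside `H` cancel the loss `(|G| / |H|) ^ (n - s)` from extending
characters, leaving `|G| ^ s * q ^ (n - s)`. -/
theorem sum_numOutside_bound_le (H : AddSubgroup G) (L n : ℕ) {q c : ℝ} (hq : 0 ≤ q) (hc : 0 ≤ c) :
    ∑ F : Fin n → G with L * numOutside F H ≤ n, (Fintype.card G : ℝ) ^ numOutside F H *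
        (((Fintype.card G / Fintype.card H : ℝ) * q) ^ (n - numOutside F H) * c) /
          (Fintype.card G : ℝ) ^ n ≤ c * smallSum L (Fintype.card G) q n := by
  refine (sum_numOutside_le H L n (fun s => (Fintype.card G : ℝ) ^ s *
    (((Fintype.card G / Fintype.card H : ℝ) * q) ^ (n - s) * c) / (Fintype.card G : ℝ) ^ n)
    fun s => by positivity).trans (le_of_eq ?_)
  rw [smallSum, Finset.mul_sum]
  refine Finset.sum_congr rfl fun σ _ => ?_
  have hσ : σ.card ≤ n := by simpa using Finset.card_le_univ σ
  have hHpos : (0 : ℝ) < Fintype.card H := by exact_mod_cast Fintype.card_pos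
  have hGpos : (0 : ℝ) < Fintype.card G := by exact_mod_cast Fintype.card_pos
  obtain ⟨t, ht⟩ := Nat.exists_eq_add_of_le hσ
  have ht' : n - σ.card = t := by omega
  have hmn : (Fintype.card G : ℝ) ^ n = (Fintype.card G : ℝ) ^ σ.card * (Fintype.card G : ℝ) ^ t := by
    rw [← pow_add, ← ht]
  rw [mul_pow, div_pow, ht', hmn]
  field_simp

/-- For all but a negligible part of the families, in proportion and in the total weight of the
generating ones, every proper subgroup misses a positive proportion of the members. -/
theorem exists_isCode_estimates [NeZero a] (hG : ∀ x : G, a • x = 0) {ρ : ℝ} (hρ0 : 0 < ρ)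
    (hρ1 : ρ < 1) :
    ∃ δ : ℝ, 0 < δ ∧
      Tendsto (fun n : ℕ => ((Finset.univ.filter fun F : Fin n → G => ¬ IsCode δ F).card : ℝ) /
        (Fintype.card G : ℝ) ^ n) atTop (𝓝 0) ∧
      Tendsto (fun n : ℕ => ∑ F : Fin n → G with
        AddSubgroup.closure (Set.range F) = ⊤ ∧ ¬ IsCode δ F,
          (∑ D : Fin n → G →+ ZMod a, ρ ^ weight D F) / (Fintype.card G : ℝ) ^ n) atTop (𝓝 0) := by
  have hq0 : 0 < (1 + ρ) / 2 := by positivity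
  obtain ⟨L, hL, hS⟩ := exists_tendsto_smallSum (Fintype.card G) (Nat.cast_nonneg _) hq0
    (by linarith)
  refine ⟨threshold L (⊤ : AddSubgroup G), threshold_pos hL _, ?_, ?_⟩
  · have hlim := (tendsto_const_nhds (x := (Fintype.card (AddSubgroup G) : ℝ))).mul hS
    rw [mul_zero] at hlim
    exact squeeze_zero (fun n => by positivity)
      (fun n => card_not_isCode_div_le hL (by linarith) n) hlim
  · obtain ⟨c, n₁, hc0, hc⟩ := exists_sum_weight_le_of_not_isCode hG hρ0 hρ1 hL
    have hlim := (tendsto_const_nhds (x := ∑ H, c H)).mul hS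
    rw [mul_zero] at hlim
    refine squeeze_zero' (Eventually.of_forall fun n => ?_) ?_ hlim
    · exact Finset.sum_nonneg fun F _ => by positivity
    filter_upwards [eventually_ge_atTop n₁] with n hn
    let h : AddSubgroup G → ℕ → ℝ := fun H s => (Fintype.card G : ℝ) ^ s *
        (((Fintype.card G / Fintype.card H : ℝ) * ((1 + ρ) / 2)) ^ (n - s) * c H) /
          (Fintype.card G : ℝ) ^ n
    have hh0 : ∀ H s, 0 ≤ h H s := fun H s => by
      have := hc0 H
      positivity
    have hite : ∀ (F : Fin n → G) (H : AddSubgroup G),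
        0 ≤ if L * numOutside F H ≤ n then h H (numOutside F H) else 0 := fun F H => by
      split_ifs
      · exact hh0 _ _
      · exact le_rfl
    calc _ ≤ ∑ F : Fin n → G with
        AddSubgroup.closure (Set.range F) = ⊤ ∧ ¬ IsCode (threshold L (⊤ : AddSubgroup G)) F,
          ∑ H : AddSubgroup G, (if L * numOutside F H ≤ n then h H (numOutside F H) else 0) := by
          refine Finset.sum_le_sum fun F hF' => ?_
          have hF := (Finset.mem_filter.1 hF').2
          obtain ⟨H, hH, hle⟩ := hc n hn F hF.1 hF.2
          refine le_trans ?_ (Finset.single_le_sum (fun H _ => hite F H) (Finset.mem_univ H))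
          rw [if_pos hH]
          exact div_le_div_of_nonneg_right hle (by positivity)
      _ ≤ ∑ F : Fin n → G,
          ∑ H : AddSubgroup G, (if L * numOutside F H ≤ n then h H (numOutside F H) else 0) :=
          Finset.sum_le_sum_of_subset_of_nonneg (Finset.subset_univ _) fun F _ _ =>
            Finset.sum_nonneg fun H _ => hite F H
      _ = ∑ H : AddSubgroup G,
          ∑ F : Fin n → G with L * numOutside F H ≤ n, h H (numOutside F H) := by
          rw [Finset.sum_comm]
          simp_rw [Finset.sum_filter]
      _ ≤ ∑ H : AddSubgroup G, c H * smallSum L (Fintype.card G) ((1 + ρ) / 2) n :=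
          Finset.sum_le_sum fun H _ => sum_numOutside_bound_le H L n hq0.le (hc0 H)
      _ = (∑ H, c H) * smallSum L (Fintype.card G) ((1 + ρ) / 2) n := (Finset.sum_mul _ _ _).symm

end Core

/-! ### Fourier coefficients of one balanced variable. -/

section SingleVariable

variable {a : ℕ} [NeZero a]

theorem exists_re_stdAddChar_le (a : ℕ) [NeZero a] :
    ∃ κ : ℝ, 0 < κ ∧ ∀ t : ZMod a, t ≠ 0 → (ZMod.stdAddChar t : ℂ).re ≤ 1 - κ := by
  have hlt : ∀ t : ZMod a, t ≠ 0 → (ZMod.stdAddChar t : ℂ).re < 1 := by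
    intro t ht
    have hn : ‖(ZMod.stdAddChar t : ℂ)‖ = 1 := AddChar.norm_apply _ _
    refine lt_of_le_of_ne ((Complex.re_le_norm _).trans hn.le) fun h => ht ?_
    have h2 := Complex.sq_norm (ZMod.stdAddChar t : ℂ)
    rw [hn, Complex.normSq_apply, h] at h2
    have him : (ZMod.stdAddChar t : ℂ).im = 0 := by nlinarith
    refine ZMod.injective_stdAddChar ?_
    rw [AddChar.map_zero_eq_one]
    exact Complex.ext (by simpa using h) (by simpa using him)
  -- The value `1` at `0` is a positive filler, so that the minimum over the whole type is positive,
  -- even when there is no nonzero `t`.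
  let f : ZMod a → ℝ := fun t => if t = 0 then 1 else 1 - (ZMod.stdAddChar t : ℂ).re
  have hf : ∀ t, 0 < f t := fun t => by
    simp only [f]
    split_ifs with h
    · exact one_pos
    · linarith [hlt t h]
  obtain ⟨t₀, ht₀⟩ := Finite.exists_min f
  refine ⟨f t₀, hf t₀, fun t ht => ?_⟩
  have := ht₀ t
  simp only [f, if_neg ht] at this ⊢
  linarith

/-- The law of an `R`-valued variable bounds its character sums. -/
theorem norm_sq_sum_stdAddChar_le {κ : ℝ}
    (hκ : ∀ t : ZMod a, t ≠ 0 → (ZMod.stdAddChar t : ℂ).re ≤ 1 - κ) (hκ0 : 0 ≤ κ) {ε : ℝ}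
    {p : ZMod a → ℝ} (hp : ∀ r, 0 ≤ p r) (hp1 : ∑ r, p r = 1) {I : Ideal (ZMod a)}
    (hI : ∀ r, ∑ s with Ideal.Quotient.mk I s = Ideal.Quotient.mk I r, p s ≤ 1 - ε)
    {b : ZMod a} (hb : ∀ t, b * t = 0 → t ∈ I) :
    ‖∑ r, (p r : ℂ) * ZMod.stdAddChar (b * r)‖ ^ 2 ≤ 1 - κ * ε := by
  -- The square is the mean of the character at the difference of two independent copies;
  -- differences outside `I` lose `κ`, and for given `r` they have mass at least `ε`.
  have hre : ‖∑ r, (p r : ℂ) * ZMod.stdAddChar (b * r)‖ ^ 2 =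
      ∑ r, ∑ s, p r * p s * (ZMod.stdAddChar (b * (r - s)) : ℂ).re := by
    have h1 : ((‖∑ r, (p r : ℂ) * ZMod.stdAddChar (b * r)‖ ^ 2 : ℝ) : ℂ) =
        ∑ r, ∑ s, ((p r * p s : ℝ) : ℂ) * ZMod.stdAddChar (b * (r - s)) := by
      push_cast
      rw [← Complex.mul_conj', map_sum, Finset.sum_mul_sum]
      refine Finset.sum_congr rfl fun r _ => Finset.sum_congr rfl fun s _ => ?_
      rw [map_mul (starRingEnd ℂ), Complex.conj_ofReal, ← AddChar.map_neg_eq_conj, mul_sub, sub_eq_add_neg,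
        AddChar.map_add_eq_mul]
      ring
    have h2 := congrArg Complex.re h1
    rw [Complex.ofReal_re, Complex.re_sum] at h2
    rw [h2]
    refine Finset.sum_congr rfl fun r _ => ?_
    rw [Complex.re_sum]
    exact Finset.sum_congr rfl fun s _ => Complex.re_ofReal_mul _ _
  rw [hre]
  have hrow : ∀ r, ∑ s, p r * p s * (ZMod.stdAddChar (b * (r - s)) : ℂ).re ≤
      p r * (1 - κ * ε) := by
    intro r
    have hterm : ∀ s, p r * p s * (ZMod.stdAddChar (b * (r - s)) : ℂ).re ≤
        p r * ((1 - κ) * p s + κ * if Ideal.Quotient.mk I s = Ideal.Quotient.mk I r then p s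
          else 0) := by
      intro s
      rw [mul_assoc]
      refine mul_le_mul_of_nonneg_left ?_ (hp r)
      have hs := hp s
      split_ifs with h
      · have hn : (ZMod.stdAddChar (b * (r - s)) : ℂ).re ≤ 1 :=
          (Complex.re_le_norm _).trans (AddChar.norm_apply _ _).le
        nlinarith
      · have hne : b * (r - s) ≠ 0 := fun h0 => h ((Ideal.Quotient.eq.2 (hb _ h0)).symm)
        have := hκ _ hne
        nlinarith
    refine (Finset.sum_le_sum fun s _ => hterm s).trans ?_
    rw [← Finset.mul_sum, Finset.sum_add_distrib, ← Finset.mul_sum, ← Finset.mul_sum, hp1,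
      ← Finset.sum_filter]
    refine mul_le_mul_of_nonneg_left ?_ (hp r)
    nlinarith [hI r]
  refine (Finset.sum_le_sum fun r _ => hrow r).trans ?_
  rw [← Finset.sum_mul, hp1, one_mul]

variable {Ω : Type*} [MeasurableSpace Ω]

theorem integrable_comp_of_finite {α E : Type*} [MeasurableSpace α] [MeasurableSingletonClass α]
    [Finite α] [NormedAddCommGroup E] {P : Measure Ω} [IsFiniteMeasure P] {Y : Ω → α}
    (hY : Measurable Y) (g : α → E) : Integrable (fun ω => g (Y ω)) P :=
  (Integrable.of_finite (μ := P.map Y) (f := g)).comp_measurable hY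

theorem integral_comp_eq_sum {α : Type*} [MeasurableSpace α] [MeasurableSingletonClass α]
    [Fintype α] {P : Measure Ω} [IsFiniteMeasure P] {Y : Ω → α}
    (hY : Measurable Y) (g : α → ℂ) :
    ∫ ω, g (Y ω) ∂P = ∑ r, (P.real {ω | Y ω = r} : ℂ) * g r := by
  rw [← integral_map (f := g) hY.aemeasurable (Integrable.of_finite).aestronglyMeasurable,
    integral_fintype Integrable.of_finite]
  refine Finset.sum_congr rfl fun r _ => ?_
  rw [map_measureReal_apply hY (measurableSet_singleton r), Complex.real_smul]
  rfl

/-- The character sums of balanced variables are uniformly bounded away from `1`. -/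
theorem exists_norm_integral_stdAddChar_le (a : ℕ) [NeZero a] {ε : ℝ} (hε : 0 < ε) :
    ∃ ρ : ℝ, 0 < ρ ∧ ρ < 1 ∧ ∀ {Ω : Type*} [MeasurableSpace Ω] (P : Measure Ω)
      [IsProbabilityMeasure P] (N : Ω → ZMod a), Measurable N → IsBalanced ε N P →
      ∀ b : ZMod a, b ≠ 0 → ‖∫ ω, ZMod.stdAddChar (b * N ω) ∂P‖ ≤ ρ := by
  obtain ⟨κ, hκ0, hκ⟩ := exists_re_stdAddChar_le a
  -- The maximum with `1 / 2` keeps `ρ` positive when `κ * ε ≥ 1`.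
  have hmax0 : (0 : ℝ) < max (1 - κ * ε) (1 / 2) := lt_max_of_lt_right (by norm_num)
  have hmax1 : max (1 - κ * ε) (1 / 2 : ℝ) < 1 :=
    max_lt (by nlinarith) (by norm_num)
  refine ⟨√(max (1 - κ * ε) (1 / 2)), Real.sqrt_pos.2 hmax0, ?_, ?_⟩
  · rw [Real.sqrt_lt' one_pos, one_pow]
    exact hmax1
  intro Ω _ P _ N hN hbal b hb
  have hmeas : ∀ r, MeasurableSet {ω | N ω = r} := fun r => hN (measurableSet_singleton r)
  have hsum : ∀ S : Finset (ZMod a), ∑ r ∈ S, P.real {ω | N ω = r} = P.real {ω | N ω ∈ S} := by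
    intro S
    rw [← measureReal_biUnion_finset]
    · congr 1
      ext ω
      simp
    · intro r _ s _ hrs
      refine Set.disjoint_left.2 fun ω h1 h2 => hrs ?_
      exact h1.symm.trans h2
    · exact fun r _ => hmeas r
  -- The annihilator of `b ≠ 0` is proper; balancedness is used modulo a maximal ideal containing
  -- it.
  let A : Ideal (ZMod a) := LinearMap.ker (LinearMap.mul (ZMod a) (ZMod a) b)
  have hA : A ≠ ⊤ := by
    rw [Ideal.ne_top_iff_one]
    simpa [A] using hb
  obtain ⟨I, hI, hAI⟩ := Ideal.exists_le_maximal A hA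
  refine Real.le_sqrt_of_sq_le (le_max_of_le_left ?_)
  rw [integral_comp_eq_sum hN fun r => ZMod.stdAddChar (b * r)]
  refine norm_sq_sum_stdAddChar_le hκ hκ0.le (fun r => measureReal_nonneg) ?_ (I := I)
    (fun r => ?_) fun t ht => hAI (by simpa [A] using ht)
  · rw [hsum]
    simp
  · rw [hsum]
    simpa using hbal I hI (Ideal.Quotient.mk I r)

end SingleVariable

/-! ### Surjections from the cokernel as annihilated generating families. -/

section Matrices

variable {a : ℕ} {G : Type*} [AddCommGroup G] [Module (ZMod a) G]

/-- `F` is annihilated by the columns of `M`. -/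
def Annihilates {n : ℕ} (F : Fin n → G) (M : Matrix (Fin n) (Fin n) (ZMod a)) : Prop :=
  ∀ j, ∑ i, M i j • F i = 0

theorem closure_range_eq_top_iff {n : ℕ} (F : Fin n → G) :
    AddSubgroup.closure (Set.range F) = ⊤ ↔
      Function.Surjective (Fintype.linearCombination (ZMod a) F) := by
  have h1 : (Submodule.span (ZMod a) (Set.range F)).toAddSubgroup =
      AddSubgroup.closure (Set.range F) := by
    apply le_antisymm
    · have : Submodule.span (ZMod a) (Set.range F) ≤
          AddSubgroup.toZModSubmodule a (AddSubgroup.closure (Set.range F)) :=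
        Submodule.span_le.2 AddSubgroup.subset_closure
      exact this
    · exact (AddSubgroup.closure_le _).2 Submodule.subset_span
  rw [← LinearMap.range_eq_top, Fintype.range_linearCombination, ← h1,
    Submodule.toAddSubgroup_eq_top]

/-- Surjections from the cokernel correspond to generating families annihilated by the columns. -/
theorem numSur_coker [Finite G] {n : ℕ} (M : Matrix (Fin n) (Fin n) (ZMod a)) :
    numSur (Coker M) G = Nat.card {F : Fin n → G //
      AddSubgroup.closure (Set.range F) = ⊤ ∧ Annihilates F M} := by
  have hker : ∀ F : Fin n → G, Annihilates F M →
      LinearMap.range M.mulVecLin ≤ LinearMap.ker (Fintype.linearCombination (ZMod a) F) := by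
    rintro F hF _ ⟨v, rfl⟩
    rw [LinearMap.mem_ker, Fintype.linearCombination_apply]
    simp only [Matrix.mulVecLin_apply, Matrix.mulVec, dotProduct, Finset.sum_smul]
    rw [Finset.sum_comm]
    refine Finset.sum_eq_zero fun j _ => ?_
    simp_rw [mul_comm (M _ j), mul_smul, ← Finset.smul_sum, hF j, smul_zero]
  symm
  refine Nat.card_eq_of_bijective (fun F => ⟨((LinearMap.range M.mulVecLin).liftQ
    (Fintype.linearCombination (ZMod a) F.1) (hker F.1 F.2.2)).toAddMonoidHom, ?_⟩) ⟨?_, ?_⟩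
  · have h := (closure_range_eq_top_iff (a := a) F.1).1 F.2.1
    intro g
    obtain ⟨v, rfl⟩ := h g
    exact ⟨Submodule.Quotient.mk v, rfl⟩
  · intro F F' h
    refine Subtype.ext (funext fun i => ?_)
    have := DFunLike.congr_fun (congrArg Subtype.val h)
      (Submodule.Quotient.mk (Pi.single i (1 : ZMod a)))
    have h' : Fintype.linearCombination (ZMod a) F.1 (Pi.single i 1) =
      Fintype.linearCombination (ZMod a) F'.1 (Pi.single i 1) := this
    simpa [Fintype.linearCombination_apply_single] using h'
  · rintro ⟨f, hf⟩
    let g : (Fin n → ZMod a) →ₗ[ZMod a] G :=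
      (f.toZModLinearMap a).comp (LinearMap.range M.mulVecLin).mkQ
    let F : Fin n → G := fun i => g (Pi.single i 1)
    have hgF : Fintype.linearCombination (ZMod a) F = g := by
      refine LinearMap.pi_ext' fun i => LinearMap.ext_ring ?_
      simp [Fintype.linearCombination_apply_single, F]
    have hgen : AddSubgroup.closure (Set.range F) = ⊤ := by
      rw [closure_range_eq_top_iff (a := a), hgF]
      exact hf.comp (Submodule.Quotient.mk_surjective _)
    have hann : Annihilates F M := by
      intro j
      have h1 : ∑ i, M i j • F i = g (M.mulVecLin (Pi.single j 1)) := by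
        rw [← hgF, Fintype.linearCombination_apply]
        simp
      rw [h1]
      have h2 : (LinearMap.range M.mulVecLin).mkQ (M.mulVecLin (Pi.single j 1)) = 0 := by
        rw [Submodule.mkQ_apply, Submodule.Quotient.mk_eq_zero]
        exact ⟨_, rfl⟩
      simp only [g, LinearMap.comp_apply, h2, map_zero]
    refine ⟨⟨F, hgen, hann⟩, Subtype.ext ?_⟩
    ext x
    obtain ⟨v, rfl⟩ := Submodule.Quotient.mk_surjective _ x
    exact DFunLike.congr_fun hgF v

end Matrices

theorem addChar_map_sum {A M ι : Type*} [AddCommMonoid A] [CommMonoid M] (ψ : AddChar A M)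
    (s : Finset ι) (f : ι → A) : ψ (∑ i ∈ s, f i) = ∏ i ∈ s, ψ (f i) := by
  induction s using Finset.induction_on with
  | empty => simp
  | insert i s hi ih => rw [Finset.sum_insert hi, Finset.prod_insert hi, ψ.map_add_eq_mul, ih]

/-- Only entries on and above the diagonal are independent, while `weight` counts ordered pairs;
this factor `2` is why each entry is later bounded by `ρ ^ 2`. -/
theorem weight_le_two_mul {a : ℕ} {G : Type*} [AddCommGroup G] {n : ℕ}
    (D : Fin n → G →+ ZMod a) (F : Fin n → G) :
    weight D F ≤ 2 * (Finset.univ.filter fun q : {q : Fin n × Fin n // q.1 ≤ q.2} =>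
      ¬ pairing D F q.1.1 q.1.2 = 0).card := by
  set T := Finset.univ.filter fun q : {q : Fin n × Fin n // q.1 ≤ q.2} =>
      ¬ pairing D F q.1.1 q.1.2 = 0 with hT
  have hsub : (Finset.univ.filter fun q : Fin n × Fin n => pairing D F q.1 q.2 ≠ 0) ⊆
      T.image (fun q => q.1) ∪ T.image (fun q => q.1.swap) := by
    intro q hq
    have hq' := (Finset.mem_filter.1 hq).2
    rw [Finset.mem_union, Finset.mem_image, Finset.mem_image]
    rcases le_total q.1 q.2 with h | h
    · left
      exact ⟨⟨q, h⟩, by simpa [hT] using hq', rfl⟩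
    · right
      refine ⟨⟨q.swap, h⟩, ?_, by simp⟩
      rw [pairing_comm] at hq'
      simpa [hT] using hq'
  unfold weight
  refine (Finset.card_le_card hsub).trans ((Finset.card_union_le _ _).trans ?_)
  have h1 := Finset.card_image_le (s := T) (f := fun q => q.1)
  have h2 := Finset.card_image_le (s := T) (f := fun q => q.1.swap)
  omega

/-! ### Fourier expansion of the moments. -/

section Moments

variable {a : ℕ} {G : Type*} [AddCommGroup G] [Module (ZMod a) G] {n : ℕ}
  {Ω : Type*} [MeasurableSpace Ω] {P : Measure Ω} {X : Ω → Matrix (Fin n) (Fin n) (ZMod a)}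

theorem measurable_entries (hX : ∀ i j, Measurable fun ω => X ω i j) :
    Measurable fun ω => (fun i j => X ω i j : Fin n → Fin n → ZMod a) :=
  measurable_pi_iff.2 fun i => measurable_pi_iff.2 fun j => hX i j

theorem measurableSet_annihilates [NeZero a] (hX : ∀ i j, Measurable fun ω => X ω i j)
    (F : Fin n → G) : MeasurableSet {ω | Annihilates F (X ω)} :=
  measurable_entries hX (.of_discrete (s := {M : Fin n → Fin n → ZMod a |
    Annihilates F (Matrix.of M)}))

theorem cokerMoment_eq_sum [NeZero a] [Fintype G] [IsProbabilityMeasure P]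
    (hX : ∀ i j, Measurable fun ω => X ω i j) :
    cokerMoment X P G = ∑ F : Fin n → G with AddSubgroup.closure (Set.range F) = ⊤,
      P.real {ω | Annihilates F (X ω)} := by
  have h : ∀ ω, (numSur (Coker (X ω)) G : ℝ) =
      ∑ F : Fin n → G with AddSubgroup.closure (Set.range F) = ⊤,
        {ω | Annihilates F (X ω)}.indicator (fun _ => (1 : ℝ)) ω := by
    intro ω
    rw [numSur_coker, Nat.card_eq_fintype_card, Fintype.card_subtype, ← Finset.filter_filter,
      Finset.card_filter]
    push_cast
    refine Finset.sum_congr rfl fun F _ => ?_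
    simp [Set.indicator_apply]
  unfold cokerMoment
  simp_rw [h]
  rw [integral_finsetSum]
  · refine Finset.sum_congr rfl fun F _ => ?_
    rw [integral_indicator_const _ (measurableSet_annihilates hX F), smul_eq_mul, mul_one]
  · intro F _
    exact (integrable_const _).indicator (measurableSet_annihilates hX F)

/-- The Fourier coefficient of the random family `∑ i, X i j • F i`. -/
noncomputable def charMean [NeZero a] (P : Measure Ω) (X : Ω → Matrix (Fin n) (Fin n) (ZMod a))
    (F : Fin n → G) (D : Fin n → G →+ ZMod a) : ℂ :=
  ∫ ω, ZMod.stdAddChar (∑ j, D j (∑ i, X ω i j • F i)) ∂P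

theorem sum_stdAddChar_family [NeZero a] [Fintype G] (y : Fin n → G) :
    ∑ D : Fin n → G →+ ZMod a, (ZMod.stdAddChar (∑ j, D j (y j)) : ℂ) =
      if ∀ j, y j = 0 then (Fintype.card G : ℂ) ^ n else 0 := by
  have hG : ∀ x : G, a • x = 0 := ZModModule.char_nsmul_eq_zero a
  simp_rw [addChar_map_sum]
  rw [← Fintype.piFinset_univ, ← Finset.prod_univ_sum (fun _ => Finset.univ)
    (fun j (χ : G →+ ZMod a) => (ZMod.stdAddChar (χ (y j)) : ℂ))]
  simp_rw [sum_dual_stdAddChar hG]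
  split_ifs with h
  · simp [h]
  · push Not at h
    obtain ⟨j, hj⟩ := h
    exact Finset.prod_eq_zero (Finset.mem_univ j) (if_neg hj)

theorem prob_annihilates_eq [NeZero a] [Fintype G] [IsProbabilityMeasure P]
    (hX : ∀ i j, Measurable fun ω => X ω i j) (F : Fin n → G) :
    (P.real {ω | Annihilates F (X ω)} : ℂ) =
      (∑ D : Fin n → G →+ ZMod a, charMean P X F D) / (Fintype.card G : ℂ) ^ n := by
  have hcard : (Fintype.card G : ℂ) ≠ 0 := by exact_mod_cast Fintype.card_ne_zero
  rw [eq_div_iff (pow_ne_zero _ hcard)]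
  unfold charMean
  rw [← integral_finsetSum]
  · simp_rw [sum_stdAddChar_family]
    have h : ∀ ω, (if ∀ j, ∑ i, X ω i j • F i = 0 then (Fintype.card G : ℂ) ^ n else 0) =
        {ω | Annihilates F (X ω)}.indicator (fun _ => (Fintype.card G : ℂ) ^ n) ω := by
      intro ω
      simp [Set.indicator_apply, Annihilates]
    simp_rw [h]
    rw [integral_indicator_const _ (measurableSet_annihilates hX F), Complex.real_smul]
  · intro D _
    exact integrable_comp_of_finite (measurable_entries hX) fun M : Fin n → Fin n → ZMod a =>
      (ZMod.stdAddChar (∑ j, D j (∑ i, M i j • F i)) : ℂ)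

/-- The pairing of a `C`-symmetric matrix with `F` and `D` in terms of the entries on and above the
diagonal. -/
theorem sum_apply_sum_smul_eq {M C : Matrix (Fin n) (Fin n) (ZMod a)} (hM : IsCSymmetric C M)
    (F : Fin n → G) (D : Fin n → G →+ ZMod a) :
    ∑ j, D j (∑ i, M i j • F i) =
      ∑ q : {q : Fin n × Fin n // q.1 ≤ q.2}, pairing D F q.1.1 q.1.2 * M q.1.1 q.1.2 -
        ∑ q : Fin n × Fin n with q.1 < q.2, C q.1 q.2 * D q.1 (F q.2) := by
  have hC : ∀ i j, M j i = M i j - C i j := by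
    intro i j
    have := congrFun (congrFun hM i) j
    rw [Matrix.sub_apply, Matrix.transpose_apply] at this
    rw [← this]
    ring
  have h1 : ∑ j, D j (∑ i, M i j • F i) = ∑ q : Fin n × Fin n, M q.1 q.2 * D q.2 (F q.1) := by
    rw [Fintype.sum_prod_type_right]
    refine Finset.sum_congr rfl fun j _ => ?_
    rw [map_sum]
    refine Finset.sum_congr rfl fun i _ => ?_
    rw [ZMod.map_smul, smul_eq_mul]
  have h2 : ∑ q : Fin n × Fin n with ¬ q.1 ≤ q.2, M q.1 q.2 * D q.2 (F q.1) =
      ∑ q : Fin n × Fin n with q.1 < q.2, (M q.1 q.2 - C q.1 q.2) * D q.1 (F q.2) := by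
    refine Finset.sum_equiv (Equiv.prodComm _ _) (fun q => by simp) fun q _ => ?_
    simp only [Equiv.prodComm_apply, Prod.fst_swap, Prod.snd_swap]
    rw [← hC]
  have h3 : ∑ q : {q : Fin n × Fin n // q.1 ≤ q.2}, pairing D F q.1.1 q.1.2 * M q.1.1 q.1.2 =
      ∑ q : Fin n × Fin n with q.1 ≤ q.2, pairing D F q.1 q.2 * M q.1 q.2 :=
    (Finset.sum_subtype _ (fun q => by simp)
      fun q : Fin n × Fin n => pairing D F q.1 q.2 * M q.1 q.2).symm
  have h4 : ∑ q : Fin n × Fin n with q.1 ≤ q.2, pairing D F q.1 q.2 * M q.1 q.2 =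
      ∑ q : Fin n × Fin n with q.1 ≤ q.2, M q.1 q.2 * D q.2 (F q.1) +
      ∑ q : Fin n × Fin n with q.1 < q.2, M q.1 q.2 * D q.1 (F q.2) := by
    have h5 : ∑ q : Fin n × Fin n with q.1 < q.2, M q.1 q.2 * D q.1 (F q.2) =
        ∑ q : Fin n × Fin n with q.1 ≤ q.2,
          if q.1 < q.2 then M q.1 q.2 * D q.1 (F q.2) else 0 := by
      rw [← Finset.sum_filter, Finset.filter_filter]
      refine Finset.sum_congr ?_ fun _ _ => rfl
      ext q
      simp only [Finset.mem_filter, Finset.mem_univ, true_and]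
      exact ⟨fun h => ⟨h.le, h⟩, fun h => h.2⟩
    rw [h5, ← Finset.sum_add_distrib]
    refine Finset.sum_congr rfl fun q hq => ?_
    have hq' : q.1 ≤ q.2 := (Finset.mem_filter.1 hq).2
    unfold pairing
    by_cases h : q.1 = q.2
    · rw [if_pos h, if_neg (by rw [h]; exact lt_irrefl _), h]
      ring
    · rw [if_neg h, if_pos (lt_of_le_of_ne hq' h)]
      ring
  rw [h1, ← Finset.sum_filter_add_sum_filter_not Finset.univ fun q : Fin n × Fin n => q.1 ≤ q.2,
    h2, h3, h4]
  simp_rw [sub_mul]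
  rw [Finset.sum_sub_distrib]
  ring

/-- Independence factors the mean over the upper triangle. The matrix `C` survives only in a factor
of modulus `1`, so upper bounds do not depend on it. -/
theorem charMean_eq [NeZero a] {ε : ℝ} {C : Matrix (Fin n) (Fin n) (ZMod a)}
    (hX : IsBalancedCSymmetric ε C X P) (F : Fin n → G) (D : Fin n → G →+ ZMod a) :
    charMean P X F D =
      ZMod.stdAddChar (-∑ q : Fin n × Fin n with q.1 < q.2, C q.1 q.2 * D q.1 (F q.2)) *
      ∏ q : {q : Fin n × Fin n // q.1 ≤ q.2},
        ∫ ω, ZMod.stdAddChar (pairing D F q.1.1 q.1.2 * X ω q.1.1 q.1.2) ∂P := by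
  unfold charMean
  have h : ∀ᵐ ω ∂P, (ZMod.stdAddChar (∑ j, D j (∑ i, X ω i j • F i)) : ℂ) =
      ZMod.stdAddChar (-∑ q : Fin n × Fin n with q.1 < q.2, C q.1 q.2 * D q.1 (F q.2)) *
      ∏ q : {q : Fin n × Fin n // q.1 ≤ q.2},
        ZMod.stdAddChar (pairing D F q.1.1 q.1.2 * X ω q.1.1 q.1.2) := by
    filter_upwards [hX.cSymmetric] with ω hω
    rw [sum_apply_sum_smul_eq hω, sub_eq_add_neg, AddChar.map_add_eq_mul,
      addChar_map_sum, mul_comm]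
  have hprod := hX.indep.integral_fun_prod_comp
    (f := fun q x => (ZMod.stdAddChar (pairing D F q.1.1 q.1.2 * x) : ℂ))
    (fun q => (hX.measurable _ _).aemeasurable)
    (fun q => (Measurable.of_discrete).aestronglyMeasurable)
  rw [integral_congr_ae h, integral_const_mul, hprod]

theorem norm_charMean_le [NeZero a] [IsProbabilityMeasure P] {ε ρ : ℝ} (hρ0 : 0 ≤ ρ) (hρ1 : ρ ≤ 1)
    (hρ : ∀ N : Ω → ZMod a, Measurable N → IsBalanced ε N P →
      ∀ b : ZMod a, b ≠ 0 → ‖∫ ω, ZMod.stdAddChar (b * N ω) ∂P‖ ≤ ρ ^ 2)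
    {C : Matrix (Fin n) (Fin n) (ZMod a)}
    (hX : IsBalancedCSymmetric ε C X P) (F : Fin n → G) (D : Fin n → G →+ ZMod a) :
    ‖charMean P X F D‖ ≤ ρ ^ weight D F := by
  rw [charMean_eq hX, norm_mul, AddChar.norm_apply, one_mul, norm_prod]
  have h : ∀ q : {q : Fin n × Fin n // q.1 ≤ q.2},
      ‖∫ ω, ZMod.stdAddChar (pairing D F q.1.1 q.1.2 * X ω q.1.1 q.1.2) ∂P‖ ≤
        if pairing D F q.1.1 q.1.2 = 0 then 1 else ρ ^ 2 := by
    intro q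
    split_ifs with hq
    · simp [hq]
    · exact hρ _ (hX.measurable _ _) (hX.balanced _ _ q.2) _ hq
  refine (Finset.prod_le_prod (fun _ _ => norm_nonneg _) fun q _ => h q).trans ?_
  rw [Finset.prod_ite, Finset.prod_const_one, one_mul, Finset.prod_const, ← pow_mul]
  exact pow_le_pow_of_le_one hρ0 hρ1 (weight_le_two_mul D F)

theorem charMean_eq_one [NeZero a] [IsProbabilityMeasure P] {ε : ℝ}
    (hX : IsBalancedCSymmetric ε 0 X P) {F : Fin n → G} {D : Fin n → G →+ ZMod a}
    (hD : IsSpecial D F) : charMean P X F D = 1 := by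
  rw [charMean_eq hX]
  simp [hD _ _]

end Moments

/-! ### Annihilation probabilities of a single family. -/

section Probability

variable {a : ℕ} [NeZero a] {G : Type*} [AddCommGroup G] [Module (ZMod a) G] [Fintype G] {n : ℕ}
  {Ω : Type*} [MeasurableSpace Ω] {P : Measure Ω} [IsProbabilityMeasure P]
  {X : Ω → Matrix (Fin n) (Fin n) (ZMod a)} {C : Matrix (Fin n) (Fin n) (ZMod a)} {ε ρ : ℝ}

theorem prob_annihilates_le (hρ0 : 0 ≤ ρ) (hρ1 : ρ ≤ 1)
    (hρ : ∀ N : Ω → ZMod a, Measurable N → IsBalanced ε N P →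
      ∀ b : ZMod a, b ≠ 0 → ‖∫ ω, ZMod.stdAddChar (b * N ω) ∂P‖ ≤ ρ ^ 2)
    (hX : IsBalancedCSymmetric ε C X P) (F : Fin n → G) :
    P.real {ω | Annihilates F (X ω)} ≤
      (∑ D : Fin n → G →+ ZMod a, ρ ^ weight D F) / (Fintype.card G : ℝ) ^ n := by
  have h := congrArg norm (prob_annihilates_eq (P := P) hX.measurable F)
  rw [Complex.norm_real, Real.norm_of_nonneg measureReal_nonneg, norm_div, norm_pow,
    Complex.norm_natCast] at h
  rw [h]
  gcongr
  exact (norm_sum_le _ _).trans (Finset.sum_le_sum fun D _ => norm_charMean_le hρ0 hρ1 hρ hX F D)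

theorem prob_annihilates_le_of_sum_le (hρ0 : 0 ≤ ρ) (hρ1 : ρ ≤ 1)
    (hρ : ∀ N : Ω → ZMod a, Measurable N → IsBalanced ε N P →
      ∀ b : ZMod a, b ≠ 0 → ‖∫ ω, ZMod.stdAddChar (b * N ω) ∂P‖ ≤ ρ ^ 2)
    (hX : IsBalancedCSymmetric ε C X P) {F : Fin n → G}
    (hF : AddSubgroup.closure (Set.range F) = ⊤) {τ : ℝ}
    (hτ : ∑ D : Fin n → G →+ ZMod a with ¬ IsSpecial D F, ρ ^ weight D F ≤ τ) :
    P.real {ω | Annihilates F (X ω)} ≤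
      (Nat.card (⋀[ℤ]^2 G) + τ) / (Fintype.card G : ℝ) ^ n := by
  refine (prob_annihilates_le hρ0 hρ1 hρ hX F).trans ?_
  gcongr
  rw [← Finset.sum_filter_add_sum_filter_not Finset.univ
    fun D : Fin n → G →+ ZMod a => IsSpecial D F]
  refine add_le_add ?_ hτ
  rw [← card_isSpecial (ZModModule.char_nsmul_eq_zero a) hF, Finset.card_eq_sum_ones]
  push_cast
  exact Finset.sum_le_sum fun D _ => pow_le_one₀ hρ0 hρ1

/-- For `C = 0` every special term equals `1` exactly, so only the non-special terms make up the
error. -/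
theorem abs_prob_annihilates_sub_le (hρ0 : 0 ≤ ρ) (hρ1 : ρ ≤ 1)
    (hρ : ∀ N : Ω → ZMod a, Measurable N → IsBalanced ε N P →
      ∀ b : ZMod a, b ≠ 0 → ‖∫ ω, ZMod.stdAddChar (b * N ω) ∂P‖ ≤ ρ ^ 2)
    (hX : IsBalancedCSymmetric ε 0 X P) {F : Fin n → G}
    (hF : AddSubgroup.closure (Set.range F) = ⊤) {τ : ℝ}
    (hτ : ∑ D : Fin n → G →+ ZMod a with ¬ IsSpecial D F, ρ ^ weight D F ≤ τ) :
    |P.real {ω | Annihilates F (X ω)} - Nat.card (⋀[ℤ]^2 G) / (Fintype.card G : ℝ) ^ n| ≤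
      τ / (Fintype.card G : ℝ) ^ n := by
  have hsp : ∑ D : Fin n → G →+ ZMod a with IsSpecial D F, charMean P X F D =
      Nat.card (⋀[ℤ]^2 G) := by
    rw [← card_isSpecial (ZModModule.char_nsmul_eq_zero a) hF, Finset.card_eq_sum_ones]
    push_cast
    exact Finset.sum_congr rfl fun D hD => charMean_eq_one hX (Finset.mem_filter.1 hD).2
  have h : ((P.real {ω | Annihilates F (X ω)} -
      Nat.card (⋀[ℤ]^2 G) / (Fintype.card G : ℝ) ^ n : ℝ) : ℂ) =
      (∑ D : Fin n → G →+ ZMod a with ¬ IsSpecial D F, charMean P X F D) /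
        (Fintype.card G : ℂ) ^ n := by
    push_cast
    rw [prob_annihilates_eq hX.measurable F,
      ← Finset.sum_filter_add_sum_filter_not Finset.univ
        fun D : Fin n → G →+ ZMod a => IsSpecial D F, hsp]
    ring
  have h' := congrArg norm h
  rw [Complex.norm_real, Real.norm_eq_abs, norm_div, norm_pow, Complex.norm_natCast] at h'
  rw [h']
  gcongr
  refine (norm_sum_le _ _).trans (le_trans ?_ hτ)
  exact Finset.sum_le_sum fun D _ => norm_charMean_le hρ0 hρ1 hρ hX F D

end Probability

/-! ### The constraint `uᵀ C v = 0`. -/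

section Bilinear

theorem two_mul_card_filter_eq_zero_le {A B : Type*} [AddCommGroup A] [AddCommGroup B] [Fintype A]
    {f : A →+ B} [DecidablePred fun x => f x = 0] (hf : f ≠ 0) :
    2 * (Finset.univ.filter fun x => f x = 0).card ≤ Fintype.card A := by
  have h1 := f.ker.index_mul_card
  have h2 : f.ker.index ≠ 1 := fun h => hf (AddMonoidHom.ker_eq_top_iff.1
    (AddSubgroup.index_eq_one.1 h))
  have h3 : f.ker.index ≠ 0 := AddSubgroup.index_ne_zero_of_finite
  have h4 : Nat.card f.ker = (Finset.univ.filter fun x => f x = 0).card := by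
    rw [Nat.card_eq_fintype_card, ← Fintype.card_subtype]
    exact Fintype.card_congr (Equiv.refl _)
  rw [Nat.card_eq_fintype_card (α := A), h4] at h1
  rw [← h1]
  exact Nat.mul_le_mul_right _ (by omega)

/-- A nonzero bilinear form vanishes on at most three quarters of the pairs. -/
theorem four_mul_card_filter_le {A A' B : Type*} [AddCommGroup A] [AddCommGroup A']
    [AddCommGroup B] [Fintype A] [Fintype A'] [DecidableEq B] {f : A →+ A' →+ B} (hf : f ≠ 0) :
    4 * (Finset.univ.filter fun p : A × A' => f p.1 p.2 = 0).card ≤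
      3 * (Fintype.card A * Fintype.card A') := by
  have h1 : (Finset.univ.filter fun p : A × A' => f p.1 p.2 = 0).card =
      ∑ u : A, (Finset.univ.filter fun v : A' => f u v = 0).card := by
    simp only [Finset.card_filter]
    rw [Fintype.sum_prod_type]
  -- At most half of the `u` have `f u = 0`, and each other `u` kills at most half of the `v`: in
  -- total `1/2 + 1/2 * 1/2 = 3/4`.
  have h2 : ∀ u : A, 2 * (Finset.univ.filter fun v : A' => f u v = 0).card ≤
      Fintype.card A' + if f u = 0 then Fintype.card A' else 0 := by
    intro u
    split_ifs with hu
    · rw [← two_mul]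
      exact Nat.mul_le_mul_left _ (Finset.card_le_univ _)
    · rw [add_zero]
      exact two_mul_card_filter_eq_zero_le hu
  have h3 : 2 * (Finset.univ.filter fun p : A × A' => f p.1 p.2 = 0).card ≤
      Fintype.card A * Fintype.card A' +
        (Finset.univ.filter fun u => f u = 0).card * Fintype.card A' := by
    rw [h1, Finset.mul_sum]
    refine (Finset.sum_le_sum fun u _ => h2 u).trans (le_of_eq ?_)
    rw [Finset.sum_add_distrib, ← Finset.sum_filter, Finset.sum_const, Finset.sum_const,
      Finset.card_univ, smul_eq_mul, smul_eq_mul]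
  have h4 := two_mul_card_filter_eq_zero_le hf
  have h5 := Nat.mul_le_mul_right (Fintype.card A') h4
  nlinarith

variable {a n : ℕ}

/-- The pairing `(u, v) ↦ uᵀ C v`. -/
def matrixForm (C : Matrix (Fin n) (Fin n) (ZMod a)) :
    (Fin n → ZMod a) →+ (Fin n → ZMod a) →+ ZMod a :=
  AddMonoidHom.mk' (fun u => AddMonoidHom.mk' (fun v => ∑ i, ∑ j, u i * C i j * v j)
    fun v w => by simp [mul_add, Finset.sum_add_distrib])
    fun u w => by
      ext v
      simp [add_mul, Finset.sum_add_distrib]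

theorem matrixForm_apply (C : Matrix (Fin n) (Fin n) (ZMod a)) (u v : Fin n → ZMod a) :
    matrixForm C u v = ∑ i, ∑ j, u i * C i j * v j := rfl

theorem matrixForm_ne_zero {C : Matrix (Fin n) (Fin n) (ZMod a)} (hC : C ≠ 0) :
    matrixForm C ≠ 0 := by
  intro h
  refine hC (Matrix.ext fun i j => ?_)
  have := DFunLike.congr_fun (DFunLike.congr_fun h (Pi.single i 1)) (Pi.single j 1)
  rw [matrixForm_apply] at this
  simpa [Pi.single_apply] using this

/-- With `u, v` the two components of `F`, both `uᵀ M` and `vᵀ M` vanish, and `uᵀ (M - Mᵀ) v = (uᵀ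
M) v - (vᵀ M) u`. -/
theorem matrixForm_eq_zero_of_annihilates {C M : Matrix (Fin n) (Fin n) (ZMod a)}
    (hM : IsCSymmetric C M) {F : Fin n → ZMod a × ZMod a} (hF : Annihilates F M) :
    matrixForm C (fun i => (F i).1) (fun i => (F i).2) = 0 := by
  have h1 : ∀ j, ∑ i, M i j * (F i).1 = 0 := fun j => by
    simpa [Prod.fst_sum] using congrArg Prod.fst (hF j)
  have h2 : ∀ j, ∑ i, M i j * (F i).2 = 0 := fun j => by
    simpa [Prod.snd_sum] using congrArg Prod.snd (hF j)
  have h3 : matrixForm C (fun i => (F i).1) (fun i => (F i).2) =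
      ∑ i, ∑ j, (F i).1 * M i j * (F j).2 - ∑ i, ∑ j, (F i).1 * M j i * (F j).2 := by
    rw [matrixForm_apply, ← hM, ← Finset.sum_sub_distrib]
    refine Finset.sum_congr rfl fun i _ => ?_
    rw [← Finset.sum_sub_distrib]
    refine Finset.sum_congr rfl fun j _ => ?_
    rw [Matrix.sub_apply, Matrix.transpose_apply]
    ring
  have h4 : ∑ i, ∑ j, (F i).1 * M i j * (F j).2 = 0 := by
    rw [Finset.sum_comm]
    refine Finset.sum_eq_zero fun j _ => ?_
    rw [← Finset.sum_mul]
    simp_rw [mul_comm (F _).1]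
    rw [h1, zero_mul]
  have h5 : ∑ i, ∑ j, (F i).1 * M j i * (F j).2 = 0 := by
    refine Finset.sum_eq_zero fun i _ => ?_
    simp_rw [mul_assoc]
    rw [← Finset.mul_sum, h2, mul_zero]
  rw [h3, h4, h5, sub_zero]

theorem four_mul_card_matrixForm_le [NeZero a] {C : Matrix (Fin n) (Fin n) (ZMod a)} (hC : C ≠ 0) :
    4 * (Finset.univ.filter fun F : Fin n → ZMod a × ZMod a =>
      matrixForm C (fun i => (F i).1) (fun i => (F i).2) = 0).card ≤
      3 * Fintype.card (ZMod a × ZMod a) ^ n := by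
  have h := four_mul_card_filter_le (matrixForm_ne_zero hC)
  have h1 : (Finset.univ.filter fun F : Fin n → ZMod a × ZMod a =>
      matrixForm C (fun i => (F i).1) (fun i => (F i).2) = 0).card =
      (Finset.univ.filter fun p : (Fin n → ZMod a) × (Fin n → ZMod a) =>
        matrixForm C p.1 p.2 = 0).card := by
    refine Finset.card_equiv (Equiv.arrowProdEquivProdArrow _ _ _) fun F => ?_
    simp [Equiv.arrowProdEquivProdArrow]
  rw [h1]
  refine h.trans (le_of_eq ?_)
  simp [mul_pow]

end Bilinear

/-! ### The limit of the moments and the converse. -/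

section Limits

variable {a : ℕ} [NeZero a] {ε : ℝ} {Ω : ℕ → Type*} [∀ n, MeasurableSpace (Ω n)]
  {P : (n : ℕ) → Measure (Ω n)} [∀ n, IsProbabilityMeasure (P n)]
  {X : (n : ℕ) → Ω n → Matrix (Fin n) (Fin n) (ZMod a)}
  {C : (n : ℕ) → Matrix (Fin n) (Fin n) (ZMod a)}

/-- The estimates for the probabilities that a family is annihilated, uniform in `n`. -/
theorem exists_uniform_estimates (hε : 0 < ε)
    (hX : ∀ n, IsBalancedCSymmetric ε (C n) (X n) (P n))
    (G : Type*) [AddCommGroup G] [Module (ZMod a) G] [Fintype G] :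
    ∃ δ : ℝ, 0 < δ ∧
      Tendsto (fun n : ℕ => ((Finset.univ.filter fun F : Fin n → G => ¬ IsCode δ F).card : ℝ) /
        (Fintype.card G : ℝ) ^ n) atTop (𝓝 0) ∧
      Tendsto (fun n : ℕ => ∑ F : Fin n → G with
        AddSubgroup.closure (Set.range F) = ⊤ ∧ ¬ IsCode δ F,
          (P n).real {ω | Annihilates F (X n ω)}) atTop (𝓝 0) ∧
      (∀ τ > 0, ∀ᶠ n in atTop, ∀ F : Fin n → G, IsCode δ F →
        (P n).real {ω | Annihilates F (X n ω)} ≤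
          (Nat.card (⋀[ℤ]^2 G) + τ) / (Fintype.card G : ℝ) ^ n) ∧
      (∀ τ > 0, ∀ᶠ n in atTop, C n = 0 → ∀ F : Fin n → G, IsCode δ F →
        |(P n).real {ω | Annihilates F (X n ω)} -
          Nat.card (⋀[ℤ]^2 G) / (Fintype.card G : ℝ) ^ n| ≤ τ / (Fintype.card G : ℝ) ^ n) := by
  obtain ⟨r, hr0, hr1, hr⟩ := exists_norm_integral_stdAddChar_le a hε
  have hG : ∀ x : G, a • x = 0 := ZModModule.char_nsmul_eq_zero a
  set ρ := √r with hρ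
  have hρ2 : ρ ^ 2 = r := Real.sq_sqrt hr0.le
  have hρ0 : 0 < ρ := Real.sqrt_pos.2 hr0
  have hρ1 : ρ < 1 := by rw [hρ, Real.sqrt_lt' one_pos, one_pow]; exact hr1
  have hbd : ∀ n, ∀ N : Ω n → ZMod a, Measurable N → IsBalanced ε N (P n) →
      ∀ b : ZMod a, b ≠ 0 → ‖∫ ω, ZMod.stdAddChar (b * N ω) ∂(P n)‖ ≤ ρ ^ 2 := by
    intro n N hN hbal b hb
    rw [hρ2]
    exact hr (P n) N hN hbal b hb
  obtain ⟨δ, hδ, hlim1, hlim2⟩ := exists_isCode_estimates (a := a) hG hρ0 hρ1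
  refine ⟨δ, hδ, hlim1, ?_, fun τ hτ => ?_, fun τ hτ => ?_⟩
  · refine squeeze_zero (fun n => Finset.sum_nonneg fun F _ => measureReal_nonneg) (fun n => ?_)
      hlim2
    exact Finset.sum_le_sum fun F _ => prob_annihilates_le hρ0.le hρ1.le (hbd n) (hX n) F
  · obtain ⟨n₀, hn₀⟩ := exists_forall_sum_not_isSpecial_le hG hρ0 hρ1 hδ hτ
    filter_upwards [eventually_ge_atTop (max n₀ 1)] with n hn F hF
    have : Nonempty (Fin n) := ⟨⟨0, (le_max_right _ _).trans hn⟩⟩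
    exact prob_annihilates_le_of_sum_le hρ0.le hρ1.le (hbd n) (hX n) (hF.closure_eq_top hδ)
      (hn₀ (Fin n) (by simpa using (le_max_left _ _).trans hn) F hF)
  · obtain ⟨n₀, hn₀⟩ := exists_forall_sum_not_isSpecial_le hG hρ0 hρ1 hδ hτ
    filter_upwards [eventually_ge_atTop (max n₀ 1)] with n hn hC F hF
    have : Nonempty (Fin n) := ⟨⟨0, (le_max_right _ _).trans hn⟩⟩
    exact abs_prob_annihilates_sub_le hρ0.le hρ1.le (hbd n) (hC ▸ hX n) (hF.closure_eq_top hδ)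
      (hn₀ (Fin n) (by simpa using (le_max_left _ _).trans hn) F hF)

theorem cokerMoment_split {n : ℕ} (hX : IsBalancedCSymmetric ε (C n) (X n) (P n))
    (hn : 0 < n) {δ : ℝ} (hδ : 0 < δ)
    (G : Type*) [AddCommGroup G] [Module (ZMod a) G] [Fintype G] :
    cokerMoment (X n) (P n) G =
      ∑ F : Fin n → G with IsCode δ F, (P n).real {ω | Annihilates F (X n ω)} +
      ∑ F : Fin n → G with AddSubgroup.closure (Set.range F) = ⊤ ∧ ¬ IsCode δ F,
        (P n).real {ω | Annihilates F (X n ω)} := by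
  have : Nonempty (Fin n) := ⟨⟨0, hn⟩⟩
  rw [cokerMoment_eq_sum hX.measurable, ← Finset.sum_filter_add_sum_filter_not _
    fun F : Fin n → G => IsCode δ F, Finset.filter_filter, Finset.filter_filter]
  congr 2
  ext F
  simp only [Finset.mem_filter, Finset.mem_univ, true_and]
  exact ⟨fun h => h.2, fun h => ⟨h.closure_eq_top hδ, h⟩⟩

/-- Almost all of the `|G| ^ n` families are codes, each contributing nearly `|∧²G| / |G| ^ n`; the
remaining generating families contribute `o(1)`. -/
theorem tendsto_cokerMoment (hε : 0 < ε)
    (hX : ∀ n, IsBalancedCSymmetric ε (C n) (X n) (P n)) (hC : ∀ᶠ n in atTop, C n = 0)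
    (G : Type*) [AddCommGroup G] [Module (ZMod a) G] [Fintype G] :
    Tendsto (fun n => cokerMoment (X n) (P n) G) atTop (𝓝 (Nat.card (⋀[ℤ]^2 G) : ℝ)) := by
  obtain ⟨δ, hδ, hlim1, hlim2, -, habs⟩ := exists_uniform_estimates hε hX G
  set w : ℝ := ((Nat.card (⋀[ℤ]^2 G) : ℕ) : ℝ) with hw
  rw [Metric.tendsto_atTop']
  intro η hη
  have hlim3 := (tendsto_const_nhds (x := w)).mul hlim1
  rw [mul_zero] at hlim3
  have h := (hlim2.eventually (gt_mem_nhds (show (0 : ℝ) < η / 4 by positivity))).and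
    ((hlim3.eventually (gt_mem_nhds (show (0 : ℝ) < η / 4 by positivity))).and
    ((habs (η / 4) (by positivity)).and (hC.and (eventually_gt_atTop 0))))
  obtain ⟨n₀, hn₀⟩ := eventually_atTop.1 h
  refine ⟨n₀, fun n hn => ?_⟩
  obtain ⟨h2, h1, h3, hCn, hn0⟩ := hn₀ n hn.le
  have h3' := h3 hCn
  rw [cokerMoment_split (hX n) hn0 hδ G, Real.dist_eq]
  have hm0 : (0 : ℝ) < (Fintype.card G : ℝ) ^ n := by
    have : (0 : ℝ) < Fintype.card G := by exact_mod_cast Fintype.card_pos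
    positivity
  have hcount : ((Finset.univ.filter fun F : Fin n → G => IsCode δ F).card : ℝ) +
      (Finset.univ.filter fun F : Fin n → G => ¬ IsCode δ F).card =
      (Fintype.card G : ℝ) ^ n := by
    have := Finset.card_filter_add_card_filter_not (s := Finset.univ)
      (fun F : Fin n → G => IsCode δ F)
    rw [Finset.card_univ, Fintype.card_fun, Fintype.card_fin] at this
    exact_mod_cast this
  have hmain : |∑ F : Fin n → G with IsCode δ F, (P n).real {ω | Annihilates F (X n ω)} -
      ∑ F : Fin n → G with IsCode δ F, w / (Fintype.card G : ℝ) ^ n| ≤ η / 4 := by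
    rw [← Finset.sum_sub_distrib]
    refine (Finset.abs_sum_le_sum_abs _ _).trans ?_
    refine (Finset.sum_le_sum fun F hF => h3' F (Finset.mem_filter.1 hF).2).trans ?_
    rw [Finset.sum_const, nsmul_eq_mul, mul_div_assoc', div_le_iff₀ hm0]
    rw [mul_comm]
    refine mul_le_mul_of_nonneg_left ?_ (by positivity)
    rw [← hcount]
    exact le_add_of_nonneg_right (Nat.cast_nonneg _)
  have hconst : ∑ F : Fin n → G with IsCode δ F, w / (Fintype.card G : ℝ) ^ n =
      w - w * (((Finset.univ.filter fun F : Fin n → G => ¬ IsCode δ F).card : ℝ) /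
        (Fintype.card G : ℝ) ^ n) := by
    rw [Finset.sum_const, nsmul_eq_mul]
    rw [eq_sub_iff_add_eq]
    rw [mul_div_assoc', mul_div_assoc', ← add_div, div_eq_iff hm0.ne', ← hcount]
    ring
  have hnn : 0 ≤ ∑ F : Fin n → G with AddSubgroup.closure (Set.range F) = ⊤ ∧ ¬ IsCode δ F,
        (P n).real {ω | Annihilates F (X n ω)} := Finset.sum_nonneg fun F _ => measureReal_nonneg
  have hnn' : 0 ≤ w * (((Finset.univ.filter fun F : Fin n → G => ¬ IsCode δ F).card : ℝ) /
        (Fintype.card G : ℝ) ^ n) := by positivity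
  rw [hconst] at hmain
  rw [abs_le] at hmain
  rw [abs_lt]
  constructor <;> linarith [hmain.1, hmain.2]

theorem eventually_eq_zero_of_tendsto (hε : 0 < ε)
    (hX : ∀ n, IsBalancedCSymmetric ε (C n) (X n) (P n))
    (h : Tendsto (fun n => cokerMoment (X n) (P n) (ZMod a × ZMod a)) atTop
      (𝓝 (Nat.card (⋀[ℤ]^2 (ZMod a × ZMod a)) : ℝ))) :
    ∀ᶠ n in atTop, C n = 0 := by
  obtain ⟨δ, hδ, -, hlim2, hle, -⟩ := exists_uniform_estimates hε hX (ZMod a × ZMod a)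
  have hfin : Finite (⋀[ℤ]^2 (ZMod a × ZMod a)) :=
    finite_exteriorPower (a := a) (ZModModule.char_nsmul_eq_zero a)
  set w : ℝ := ((Nat.card (⋀[ℤ]^2 (ZMod a × ZMod a)) : ℕ) : ℝ) with hw
  have hw1 : 1 ≤ w := by
    rw [hw]
    exact_mod_cast Nat.card_pos (α := ⋀[ℤ]^2 (ZMod a × ZMod a))
  -- The margin `1 / 16` suffices: `C n ≠ 0` would give `w - 1/16 < 3/4 * (w + 1/16) + 1/16`, which
  -- is false for `w ≥ 1`.
  filter_upwards [hlim2.eventually (gt_mem_nhds (show (0 : ℝ) < 1 / 16 by norm_num)),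
    hle (1 / 16) (by norm_num), h.eventually (lt_mem_nhds (show w - 1 / 16 < w by linarith)),
    eventually_gt_atTop 0] with n h1 h2 h3 hn
  by_contra hC
  rw [cokerMoment_split (hX n) hn hδ] at h3
  have hm0 : (0 : ℝ) < (Fintype.card (ZMod a × ZMod a) : ℝ) ^ n := by
    have : (0 : ℝ) < Fintype.card (ZMod a × ZMod a) := by exact_mod_cast Fintype.card_pos
    positivity
  have hterm : ∀ F : Fin n → ZMod a × ZMod a, IsCode δ F →
      (P n).real {ω | Annihilates F (X n ω)} ≤
        if matrixForm (C n) (fun i => (F i).1) (fun i => (F i).2) = 0 then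
          (w + 1 / 16) / (Fintype.card (ZMod a × ZMod a) : ℝ) ^ n else 0 := by
    intro F hF
    split_ifs with hform
    · exact h2 F hF
    · have hnull : (P n) {ω | Annihilates F (X n ω)} = 0 := by
        have hae := (hX n).cSymmetric
        rw [ae_iff] at hae
        refine measure_mono_null (fun ω hω => ?_) hae
        refine fun hsymm => hform ?_
        exact matrixForm_eq_zero_of_annihilates hsymm hω
      rw [measureReal_def, hnull]
      simp
  have hcode : ∑ F : Fin n → ZMod a × ZMod a with IsCode δ F,
      (P n).real {ω | Annihilates F (X n ω)} ≤ 3 / 4 * (w + 1 / 16) := by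
    refine (Finset.sum_le_sum fun F hF => hterm F (Finset.mem_filter.1 hF).2).trans ?_
    refine (Finset.sum_le_sum_of_subset_of_nonneg (Finset.subset_univ _) fun F _ _ => ?_).trans ?_
    · split_ifs <;> positivity
    rw [← Finset.sum_filter, Finset.sum_const, nsmul_eq_mul, mul_div_assoc', div_le_iff₀ hm0]
    have hcard : 4 * ((Finset.univ.filter fun F : Fin n → ZMod a × ZMod a =>
      matrixForm (C n) (fun i => (F i).1) (fun i => (F i).2) = 0).card : ℝ) ≤
      3 * (Fintype.card (ZMod a × ZMod a) : ℝ) ^ n := by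
      exact_mod_cast four_mul_card_matrixForm_le hC
    nlinarith
  linarith

end Limits

end

end CSymm

theorem mainTheorem3 (a : ℕ) (ha : 0 < a) (ε : ℝ) (hε : 0 < ε)
    (C : (n : ℕ) → Matrix (Fin n) (Fin n) (ZMod a))
    (hC : ∀ n, CSymm.IsAlternating (C n))
    (Ω : ℕ → Type*) [∀ n, MeasurableSpace (Ω n)]
    (P : (n : ℕ) → Measure (Ω n)) [∀ n, IsProbabilityMeasure (P n)]
    (X : (n : ℕ) → Ω n → Matrix (Fin n) (Fin n) (ZMod a))
    (hX : ∀ n, CSymm.IsBalancedCSymmetric ε (C n) (X n) (P n)) :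
    (∀ (G : Type) [AddCommGroup G] [Finite G], AddMonoid.exponent G ∣ a →
        Tendsto (fun n => CSymm.cokerMoment (X n) (P n) G) atTop
          (𝓝 (Nat.card (⋀[ℤ]^2 G) : ℝ))) ↔
      ∀ᶠ n in atTop, C n = 0 := by
  have : NeZero a := ⟨ha.ne'⟩
  constructor
  · intro h
    refine CSymm.eventually_eq_zero_of_tendsto hε hX (h (ZMod a × ZMod a) ?_)
    exact AddMonoid.exponent_dvd_of_forall_nsmul_eq_zero (ZModModule.char_nsmul_eq_zero a)
  · intro h G _ _ hG
    have := Fintype.ofFinite G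
    let _ : Module (ZMod a) G :=
      AddCommGroup.zmodModule (AddMonoid.exponent_dvd_iff_forall_nsmul_eq_zero.1 hG)
    exact CSymm.tendsto_cokerMoment hε hX h G
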